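/- Let $v_2<v_1$ be nonzero reals with either $v_2<0<v_1$ or $0<v_2<v_1$, and let $\lambda,\xi>0$, $0\le q\le 1$. A geometric counting process (GCP) of intensity $\lambda$ is a mixed Poisson process whose random intensity $\alpha$ is exponential with mean $\lambda$; that is, conditionally on $\alpha$, its intertimes are independent and exponential with rate $\alpha$. For $j\in\{1,2\}$, let $X(t)=\int_0^t V(s)\,ds$ be the motion on the line with $V(0)=v_j$, $X(0)=0$, whose velocity $V(t)=\frac{v_1+v_2}{2}+(-1)^{j-1}\frac{v_1-v_2}{2}(-1)^{N(t)}$ alternates between $v_1$ and $v_2$; here $N(t)$ is the number of velocity changes up to time $t$, and the successive durations of the motion along $v_1$, and those along $v_2$, are the intertimes of two independent GCPs of intensity $\lambda$. Let $\widetilde X(t)$ be the motion obtained by resetting the position to $0$ at the epochs of a Poisson process of rate $\xi$: after each reset the motion starts again from the origin with velocity equal to the initial velocity $V(0)$ and with durations governed by two independent GCPs of intensity $\lambda$, where, for each cycle between resets, the two GCPs, the reset process and $V(0)$ are mutually independent (no assumption is needed on the joint law of different cycles). Let the initial velocity be random, $P\{V(0)=v_1\}=q$, $P\{V(0)=v_2\}=1-q$.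 Then, for every $t>0$, the law of $\widetilde X(t)$ is the measure on $\mathbb R$ with generalized density $$\widetilde p(x,t)=qH_1(x,t)+(1-q)H_2(x,t)+\mathbf 1_{\{v_2t<x<v_1t\}}\frac{\lambda e^{-\xi t}}{(v_1-v_2)(1+\lambda t)}+\frac{\xi e^{\xi/\lambda}}{v_1-v_2}\,I(x,t)\,\Gamma_\lambda^\xi(x,t),$$ where, with $\delta$ the Dirac delta, $$H_j(x,t)=\frac{e^{-\xi t}\,\delta(x-v_jt)}{1+\lambda t}+\operatorname{sgn}(v_j)\,\mathbf 1_{\{0<x/v_j<t\}}\frac{\xi e^{-\xi x/v_j}}{v_j+\lambda x},\qquad j=1,2,$$ $I(x,t)=\mathbf 1_{\{\min\{v_2t,0\}<x<v_1t\}}$, and, with $\Gamma(0,z_0,z_1)=\int_{z_0}^{z_1}u^{-1}e^{-u}\,du$, $$\Gamma_\lambda^\xi(x,t)=\begin{cases}\Gamma\big(0,(\max\{\tfrac{x}{v_1},\tfrac{x}{v_2}\}+\tfrac1\lambda)\xi,(t+\tfrac1\lambda)\xi\big), & v_2<0<v_1,\\[1ex] \Gamma\big(0,(\tfrac{x}{v_1}+\tfrac1\lambda)\xi,(\min\{\tfrac{x}{v_2},t\}+\tfrac1\lambda)\xi\big),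 & 0<v_2<v_1.\end{cases}$$ -/

import Mathlib

open MeasureTheory ProbabilityTheory

noncomputable section

namespace ResetTelegraph

/-! ### Counting processes, described by their intertimes -/

/-- The `n`-th epoch `d 0 + ⋯ + d (n - 1)` of the sequence of intertimes `d`; epoch `0` is `0`. -/
def epoch (d : ℕ → ℝ) (n : ℕ) : ℝ := ∑ k ∈ Finset.range n, d k

/-- The number of epochs (of index at least one) that occur up to and including time `t`. -/
def count (d : ℕ → ℝ) (t : ℝ) : ℕ := {n : ℕ | epoch d (n + 1) ≤ t}.ncard

/-- `D` is the sequence of intertimes of a Poisson process of intensity `r`: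
independent exponential random variables of rate `r`. -/
structure IsPoissonIntertimes {Ω : Type*} [MeasurableSpace Ω] (P : Measure Ω) (r : ℝ)
    (D : ℕ → Ω → ℝ) : Prop where
  measurable : ∀ k, Measurable (D k)
  law : ∀ k, P.map (D k) = expMeasure r
  indep : iIndepFun D P

/-- `D` is the sequence of intertimes of a geometric counting process of intensity `lam`, that is,
of a mixed Poisson process whose random intensity `α` is exponential with mean `lam`
(rate `lam⁻¹`): given `α`, the intertimes are independent and exponential of rate `α`. -/
structure IsGCPIntertimes {Ω : Type*} [MeasurableSpace Ω] (P : Measure Ω) (lam : ℝ)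
    (D : ℕ → Ω → ℝ) : Prop where
  measurable : ∀ k, Measurable (D k)
  law : ∀ (n : ℕ) (B : ℕ → Set ℝ), (∀ k, MeasurableSet (B k)) →
    P {ω | ∀ k < n, D k ω ∈ B k} =
      ∫⁻ α, ∏ k ∈ Finset.range n, expMeasure α (B k) ∂(expMeasure lam⁻¹)

/-! ### The motion without resets

Index `0 : Fin 2` stands for the velocity `v₁` and index `1 : Fin 2` for the velocity `v₂`. -/

/-- The successive durations of the motion that starts with the velocity of index `j`, where
`d i k` is the length of the `(k + 1)`-st time interval spent with the velocity of index `i`. -/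
def alternating (j : Fin 2) (d : Fin 2 → ℕ → ℝ) (k : ℕ) : ℝ :=
  if Even k then d j (k / 2) else d (j + 1) (k / 2)

/-- The velocity at time `t`:
`(v₁ + v₂) / 2 ± (v₁ - v₂) / 2 * (-1) ^ N(t)`, where `N(t)` is the number of velocity changes. -/
def velocity (v₁ v₂ : ℝ) (j : Fin 2) (d : Fin 2 → ℕ → ℝ) (t : ℝ) : ℝ :=
  (v₁ + v₂) / 2 + (-1) ^ (j : ℕ) * ((v₁ - v₂) / 2) * (-1) ^ count (alternating j d) t

/-- The position at time `t` of the motion that starts from the origin. -/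
def position (v₁ v₂ : ℝ) (j : Fin 2) (d : Fin 2 → ℕ → ℝ) (t : ℝ) : ℝ :=
  ∫ s in (0 : ℝ)..t, velocity v₁ v₂ j d s

/-! ### The motion with resets -/

/-- The position at time `t` of the motion with resets to the origin. The times between resets are
`r`; after the `m`-th reset the motion starts again from the origin, with its initial velocity (of
index `j`) and with the durations `d m`. If `m` resets occurred up to time `t`, the last one
took place at the `m`-th epoch of `r` (at time `0`, if `m = 0`). -/
def resetPosition (v₁ v₂ : ℝ) (j : Fin 2) (r : ℕ → ℝ) (d : ℕ → Fin 2 → ℕ → ℝ) (t : ℝ) : ℝ :=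
  position v₁ v₂ j (d (count r t)) (t - epoch r (count r t))

/-- The random objects that drive the motion with resets and with random initial velocity.
The initial velocity has index `J`, equal to `0` with probability `q` and to `1` with probability
`1 - q`; the resets form a Poisson process of intensity `ξ`; in each cycle `m` between resets, the
durations of the motion along the two velocities are given by two geometric counting processes of
intensity `lam`; and for each `m` these two processes, the resets and the initial velocity are
mutually independent. Nothing is asked about the joint law of different cycles: they may be
independent of each other, or share the random intensities of their counting processes. -/
structure IsDrivingSystem {Ω : Type*} [MeasurableSpace Ω] (P : Measure Ω) (q lam ξ : ℝ)
    (J : Ω → Fin 2) (R : ℕ → Ω → ℝ) (D : ℕ → Fin 2 → ℕ → Ω → ℝ) : Prop where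
  measurable_initial : Measurable J
  initial_zero : P {ω | J ω = 0} = ENNReal.ofReal q
  initial_one : P {ω | J ω = 1} = ENNReal.ofReal (1 - q)
  resets : IsPoissonIntertimes P ξ R
  durations : ∀ m i, IsGCPIntertimes P lam (D m i)
  indep_initial : ∀ m, IndepFun J (fun ω => ((fun k => R k ω), fun i k => D m i k ω)) P
  indep_resets : ∀ m, IndepFun (fun ω k => R k ω) (fun ω i k => D m i k ω) P
  indep_durations : ∀ m, IndepFun (fun ω k => D m 0 k ω) (fun ω k => D m 1 k ω) P

/-! ### The functions in the formula for the law -/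

/-- The generalized incomplete Gamma function `Γ(a, z₀, z₁)`. -/
def genIncGamma (a z₀ z₁ : ℝ) : ℝ := ∫ u in z₀..z₁, u ^ (a - 1) * Real.exp (-u)

/-- The function `Γ_λ^ξ(x, t)`, for `v₂ < 0 < v₁` (first case) or `0 < v₂ < v₁` (second case). -/
def gammaFun (v₁ v₂ lam ξ x t : ℝ) : ℝ :=
  if v₂ < 0 then
    genIncGamma 0 ((max (x / v₁) (x / v₂) + 1 / lam) * ξ) ((t + 1 / lam) * ξ)
  else
    genIncGamma 0 ((x / v₁ + 1 / lam) * ξ) ((min (x / v₂) t + 1 / lam) * ξ)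

open Classical in
/-- The indicator `𝟙_A` of a proposition `A`. -/
def ind (A : Prop) : ℝ := if A then 1 else 0

/-- The absolutely continuous measure on the line with density `f`. -/
def ofDensity (f : ℝ → ℝ) : Measure ℝ := volume.withDensity fun x => ENNReal.ofReal (f x)

/-- The measure whose generalized density is
`e^{-ξt} δ(x - vt) / (1 + λt) + sgn(v) 𝟙_{0 < x/v < t} ξ e^{-ξx/v} / (v + λx)`. -/
def H (lam ξ v t : ℝ) : Measure ℝ :=
  ENNReal.ofReal (Real.exp (-ξ * t) / (1 + lam * t)) • Measure.dirac (v * t) +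
    ofDensity fun x =>
      SignType.sign v * ind (0 < x / v ∧ x / v < t) * (ξ * Real.exp (-ξ * (x / v)) / (v + lam * x))

end ResetTelegraph

end

noncomputable section

namespace ResetTelegraph

/-! ### Counting epochs along a path -/

-- Fix the initial velocity `v_j` and ignore the resets at first. The position at time `s` is `v_j T
-- + v_{j+1} (s - T)`, where `T` is the time spent at the initial velocity, so the law of `T`
-- decides everything. If the `y`-th unit of time at the initial velocity ends in the `(n+1)`-st
-- period of that velocity, then `n` full periods of the other one precede it, so `T ≥ y` exactly
-- when these fit into `s - y` (`exists_position_eq`). The `n`-th epoch of a GCP is at most `z` with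
-- probability `(λz/(1+λz))^n` (`IsGCPIntertimes.measure_epoch_le`). Independence and a geometric
-- series then give `P(T ≥ y) = (1+λ(s-y))/(1+λs)` for `0 < y ≤ s`
-- (`IsGCPIntertimes.measure_exists_epoch`). This is affine in `y`: `T` has an atom `1/(1+λs)` at
-- `s` and is otherwise uniform on `(0, s)`. Hence the position has an atom at `v_j s` and a
-- constant density on `(v₂s, v₁s)` that does not depend on `j` (`map_position`).
--
-- Reset epochs have total density `ξ`, and each is followed by a reset-free time `s` with
-- probability `e^{-ξs}`. So the time since the last reset is `t` with probability `e^{-ξt}` and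
-- otherwise has density `ξe^{-ξs}` on `(0, t)` (`IsPoissonIntertimes.tsum_lintegral_age`).
-- Averaging the law above over this age, the value `t` gives the Dirac term and the constant
-- density; the ages `s < t` smear the atom along `x = v_j s` (`lintegral_atom`) and turn the
-- constant densities into an integral over the `s` with `v₂s < x < v₁s`, an incomplete Gamma
-- function after `u = ξ(s+1/λ)` (`lintegral_motionLaw_density`). Only the `H_j` depend on the
-- initial velocity, so only they carry the weights `q` and `1 - q`.

theorem epoch_zero (d : ℕ → ℝ) : epoch d 0 = 0 := by simp [epoch]

theorem epoch_succ (d : ℕ → ℝ) (n : ℕ) : epoch d (n + 1) = epoch d n + d n := by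
  simp [epoch, Finset.sum_range_succ]

/-- A sequence of positive intertimes whose epochs are unbounded. -/
structure IsRegular (d : ℕ → ℝ) : Prop where
  pos : ∀ k, 0 < d k
  unbounded : ∀ t, ∃ n, t < epoch d n

theorem IsRegular.strictMono {d : ℕ → ℝ} (h : IsRegular d) : StrictMono (epoch d) :=
  strictMono_nat_of_lt_succ fun n => by rw [epoch_succ]; linarith [h.pos n]

theorem IsRegular.epoch_nonneg {d : ℕ → ℝ} (h : IsRegular d) (n : ℕ) : 0 ≤ epoch d n := by
  rw [← epoch_zero d]; exact h.strictMono.monotone (Nat.zero_le n)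

theorem IsRegular.exists_mem_Ico {d : ℕ → ℝ} (h : IsRegular d) {t : ℝ} (ht : 0 ≤ t) :
    ∃ n, epoch d n ≤ t ∧ t < epoch d (n + 1) := by
  classical
  have hne := h.unbounded t
  have h0 : Nat.find hne ≠ 0 := by
    intro h0
    have := Nat.find_spec hne
    rw [h0, epoch_zero] at this
    linarith
  obtain ⟨n, hn⟩ := Nat.exists_eq_succ_of_ne_zero h0
  refine ⟨n, ?_, ?_⟩
  · have := Nat.find_min hne (m := n) (by omega)
    linarith
  · have := Nat.find_spec hne
    rwa [hn] at this

theorem IsRegular.exists_mem_Ioc {d : ℕ → ℝ} (h : IsRegular d) {t : ℝ} (ht : 0 < t) :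
    ∃ n, epoch d n < t ∧ t ≤ epoch d (n + 1) := by
  classical
  have hne : ∃ n, t ≤ epoch d n := (h.unbounded t).imp fun _ => le_of_lt
  have h0 : Nat.find hne ≠ 0 := by
    intro h0
    have := Nat.find_spec hne
    rw [h0, epoch_zero] at this
    linarith
  obtain ⟨n, hn⟩ := Nat.exists_eq_succ_of_ne_zero h0
  refine ⟨n, ?_, ?_⟩
  · have := Nat.find_min hne (m := n) (by omega)
    linarith
  · have := Nat.find_spec hne
    rwa [hn] at this

theorem count_eq_of_strictMono {d : ℕ → ℝ} (h : StrictMono (epoch d)) {n : ℕ} {t : ℝ}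
    (h₁ : epoch d n ≤ t) (h₂ : t < epoch d (n + 1)) : count d t = n := by
  have : {m : ℕ | epoch d (m + 1) ≤ t} = (Finset.range n : Set ℕ) := by
    ext m
    simp only [Set.mem_ofPred_eq, Finset.coe_range, Set.mem_Iio]
    constructor
    · intro hm
      have := h.lt_iff_lt.1 (hm.trans_lt h₂)
      omega
    · intro hm
      exact (h.monotone (show m + 1 ≤ n by omega)).trans h₁
  rw [count, this, Set.ncard_coe_finset, Finset.card_range]

theorem IsRegular.count_eq_iff {d : ℕ → ℝ} (h : IsRegular d) {n : ℕ} {t : ℝ} (ht : 0 ≤ t) :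
    count d t = n ↔ epoch d n ≤ t ∧ t < epoch d (n + 1) := by
  refine ⟨?_, fun hn => count_eq_of_strictMono h.strictMono hn.1 hn.2⟩
  rintro rfl
  obtain ⟨n, hn⟩ := h.exists_mem_Ico ht
  rwa [count_eq_of_strictMono h.strictMono hn.1 hn.2]

/-! ### Measurability -/

theorem measurable_ncard {α : Type*} [MeasurableSpace α] {S : α → Set ℕ}
    (hS : ∀ n, MeasurableSet {a | n ∈ S a}) : Measurable fun a => (S a).ncard := by
  have key : ∀ n, n ≠ 0 → MeasurableSet {a | (S a).ncard = n} := by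
    intro n hn
    have : {a | (S a).ncard = n} =
        ⋃ F ∈ {F : Finset ℕ | F.card = n}, ⋂ k, {a | k ∈ S a ↔ k ∈ F} := by
      ext a
      simp only [Set.mem_ofPred_eq, Set.mem_iUnion, Set.mem_iInter, exists_prop]
      constructor
      · intro h
        have hf : (S a).Finite := Set.finite_of_ncard_ne_zero (by omega)
        exact ⟨hf.toFinset, by rw [← h, Set.ncard_eq_toFinset_card _ hf], fun k => by simp⟩
      · rintro ⟨F, hF, h⟩
        have : S a = F := Set.ext fun k => by simpa using h k
        rw [this, Set.ncard_coe_finset, hF]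
    rw [this]
    refine MeasurableSet.biUnion (Set.to_countable _) fun F _ => MeasurableSet.iInter fun k => ?_
    by_cases hk : k ∈ F
    · simpa [hk] using hS k
    · simpa only [hk, iff_false, Set.compl_ofPred] using (hS k).compl
  refine measurable_to_countable' fun n => ?_
  -- `ncard` is `0` on infinite sets as well, so the level `0` is reached as the complement of all
  -- the others.
  by_cases hn : n = 0
  · have : (fun a => (S a).ncard) ⁻¹' {n} = (⋃ m ∈ {m : ℕ | m ≠ 0}, {a | (S a).ncard = m})ᶜ := by
      ext a; simp [hn]; grind
    rw [this]
    exact (MeasurableSet.biUnion (Set.to_countable _) fun m hm => key m hm).compl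
  · exact key n hn

@[fun_prop]
theorem measurable_epoch (n : ℕ) : Measurable fun d : ℕ → ℝ => epoch d n := by
  unfold epoch
  fun_prop

theorem measurable_count : Measurable fun p : (ℕ → ℝ) × ℝ => count p.1 p.2 :=
  measurable_ncard fun n =>
    measurableSet_le ((measurable_epoch (n + 1)).comp measurable_fst) measurable_snd

theorem measurable_alternating (j : Fin 2) : Measurable (alternating j) := by
  refine measurable_pi_lambda _ fun k => ?_
  unfold alternating
  split_ifs <;> fun_prop

theorem measurable_velocity (v₁ v₂ : ℝ) (j : Fin 2) :
    Measurable fun p : (Fin 2 → ℕ → ℝ) × ℝ => velocity v₁ v₂ j p.1 p.2 := by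
  have hp : Measurable fun p : (Fin 2 → ℕ → ℝ) × ℝ => (alternating j p.1, p.2) :=
    ((measurable_alternating j).comp measurable_fst).prodMk measurable_snd
  have h : Measurable ((fun p : (ℕ → ℝ) × ℝ => count p.1 p.2) ∘
      fun p : (Fin 2 → ℕ → ℝ) × ℝ => (alternating j p.1, p.2)) := measurable_count.comp hp
  have h' : Measurable fun n : ℕ => (-1 : ℝ) ^ n := measurable_of_countable _
  exact measurable_const.add (measurable_const.mul (h'.comp h))

theorem measurable_position (v₁ v₂ : ℝ) (j : Fin 2) :
    Measurable fun p : (Fin 2 → ℕ → ℝ) × ℝ => position v₁ v₂ j p.1 p.2 := by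
  have hp : Measurable fun p : ((Fin 2 → ℕ → ℝ) × ℝ) × ℝ => (p.1.1, p.2) := by fun_prop
  have hv := (measurable_velocity v₁ v₂ j).comp hp
  have h₁ : MeasurableSet {p : ((Fin 2 → ℕ → ℝ) × ℝ) × ℝ | p.2 ∈ Set.Ioc 0 p.1.2} :=
    (measurableSet_lt measurable_const measurable_snd).inter
      (measurableSet_le measurable_snd (by fun_prop))
  have h₂ : MeasurableSet {p : ((Fin 2 → ℕ → ℝ) × ℝ) × ℝ | p.2 ∈ Set.Ioc p.1.2 0} :=
    (measurableSet_lt (by fun_prop) measurable_snd).inter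
      (measurableSet_le measurable_snd measurable_const)
  -- The time may be negative here, so the oriented integral is a difference of two set integrals,
  -- each measurable in its parameters.
  have m₁ := ((hv.indicator h₁).stronglyMeasurable.integral_prod_right' (ν := volume)).measurable
  have m₂ := ((hv.indicator h₂).stronglyMeasurable.integral_prod_right' (ν := volume)).measurable
  convert m₁.sub m₂ using 2 with p
  rw [position, intervalIntegral, Pi.sub_apply, ← integral_indicator measurableSet_Ioc,
    ← integral_indicator measurableSet_Ioc]
  rfl

theorem measurable_resetPosition (v₁ v₂ t : ℝ) :
    Measurable fun p : Fin 2 × (ℕ → ℝ) × (ℕ → Fin 2 → ℕ → ℝ) =>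
      resetPosition v₁ v₂ p.1 p.2.1 p.2.2 t := by
  refine measurable_from_prod_countable_right fun j => ?_
  -- The number of resets is freed as a separate variable: it is countable, so measurability for
  -- each fixed value suffices.
  have h : Measurable fun x : ℕ × (ℕ → ℝ) × (ℕ → Fin 2 → ℕ → ℝ) =>
      position v₁ v₂ j (x.2.2 x.1) (t - epoch x.2.1 x.1) := by
    refine measurable_from_prod_countable_right fun m => ?_
    have hp : Measurable fun x : (ℕ → ℝ) × (ℕ → Fin 2 → ℕ → ℝ) => (x.2 m, t - epoch x.1 m) := by
      fun_prop
    have hc := (measurable_position v₁ v₂ j).comp hp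
    simpa only [Function.comp_def] using hc
  have hp : Measurable fun x : (ℕ → ℝ) × (ℕ → Fin 2 → ℕ → ℝ) => (x.1, t) := by fun_prop
  have hq := (measurable_count.comp hp).prodMk measurable_id
  have hc := h.comp hq
  simpa only [resetPosition, Function.comp_def, id_eq] using hc

/-! ### The position along a path -/

/-- The velocity of index `j`. -/
def vel (v₁ v₂ : ℝ) (j : Fin 2) : ℝ := if j = 0 then v₁ else v₂

theorem velocity_eq (v₁ v₂ : ℝ) (j : Fin 2) (d : Fin 2 → ℕ → ℝ) (t : ℝ) :
    velocity v₁ v₂ j d t =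
      if Even (count (alternating j d) t) then vel v₁ v₂ j else vel v₁ v₂ (j + 1) := by
  unfold velocity
  split_ifs with h
  · rw [h.neg_one_pow]
    fin_cases j <;> simp [vel] <;> ring
  · rw [(Nat.not_even_iff_odd.1 h).neg_one_pow]
    fin_cases j <;> simp [vel] <;> ring

theorem epoch_alternating_even (j : Fin 2) (d : Fin 2 → ℕ → ℝ) (k : ℕ) :
    epoch (alternating j d) (2 * k) = epoch (d j) k + epoch (d (j + 1)) k := by
  induction k with
  | zero => simp [epoch_zero]
  | succ k ih =>
    rw [show 2 * (k + 1) = 2 * k + 1 + 1 by ring, epoch_succ, epoch_succ, epoch_succ, epoch_succ,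
      ih]
    have h₁ : alternating j d (2 * k) = d j k := by simp [alternating]
    have h₂ : alternating j d (2 * k + 1) = d (j + 1) k := by
      rw [alternating, if_neg (by simp), show (2 * k + 1) / 2 = k by omega]
    rw [h₁, h₂]
    ring

theorem epoch_alternating_odd (j : Fin 2) (d : Fin 2 → ℕ → ℝ) (k : ℕ) :
    epoch (alternating j d) (2 * k + 1) = epoch (d j) (k + 1) + epoch (d (j + 1)) k := by
  rw [epoch_succ, epoch_alternating_even, epoch_succ]
  have h₁ : alternating j d (2 * k) = d j k := by simp [alternating]
  rw [h₁]
  ring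

theorem IsRegular.alternating {d : Fin 2 → ℕ → ℝ} (h : ∀ i, IsRegular (d i)) (j : Fin 2) :
    IsRegular (alternating j d) where
  pos k := by
    unfold ResetTelegraph.alternating
    split_ifs
    · exact (h j).pos _
    · exact (h _).pos _
  unbounded t := by
    obtain ⟨n, hn⟩ := (h j).unbounded t
    exact ⟨2 * n, by rw [epoch_alternating_even]; linarith [(h (j + 1)).epoch_nonneg n]⟩

/-- Between two consecutive velocity changes, the velocity is constant. -/
theorem integral_velocity_of_mem_Icc {v₁ v₂ : ℝ} {j : Fin 2} {d : Fin 2 → ℕ → ℝ}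
    (h : ∀ i, IsRegular (d i)) (n : ℕ) {a s : ℝ}
    (h₁ : epoch (alternating j d) n ≤ a) (has : a ≤ s)
    (h₂ : s ≤ epoch (alternating j d) (n + 1)) :
    IntervalIntegrable (velocity v₁ v₂ j d) volume a s ∧
    ∫ u in a..s, velocity v₁ v₂ j d u =
      (if Even n then vel v₁ v₂ j else vel v₁ v₂ (j + 1)) * (s - a) := by
  have hE := IsRegular.alternating h j
  have key : ∀ u ∈ Set.Ioo a s, velocity v₁ v₂ j d u =
      if Even n then vel v₁ v₂ j else vel v₁ v₂ (j + 1) := by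
    intro u hu
    rw [velocity_eq, count_eq_of_strictMono hE.strictMono (h₁.trans hu.1.le) (hu.2.trans_le h₂)]
  constructor
  · rw [intervalIntegrable_iff_integrableOn_Ioo_of_le has]
    exact (integrableOn_congr_fun key measurableSet_Ioo).2 (by simp)
  · rw [intervalIntegral.integral_of_le has, integral_Ioc_eq_integral_Ioo,
      setIntegral_congr_fun measurableSet_Ioo key]
    simp [has, mul_comm]

theorem integral_velocity_epoch (v₁ v₂ : ℝ) (j : Fin 2) {d : Fin 2 → ℕ → ℝ}
    (h : ∀ i, IsRegular (d i)) (k : ℕ) :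
    IntervalIntegrable (velocity v₁ v₂ j d) volume 0 (epoch (alternating j d) (2 * k)) ∧
    ∫ u in (0 : ℝ)..epoch (alternating j d) (2 * k), velocity v₁ v₂ j d u =
      vel v₁ v₂ j * epoch (d j) k + vel v₁ v₂ (j + 1) * epoch (d (j + 1)) k := by
  have hE := IsRegular.alternating h j
  induction k with
  | zero => simp [epoch_zero]
  | succ k ih =>
    have e₁ := integral_velocity_of_mem_Icc (v₁ := v₁) (v₂ := v₂) h (2 * k) le_rfl
      (hE.strictMono (Nat.lt_add_one (2 * k))).le le_rfl
    have e₂ := integral_velocity_of_mem_Icc (v₁ := v₁) (v₂ := v₂) h (2 * k + 1) le_rfl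
      (hE.strictMono (Nat.lt_add_one (2 * k + 1))).le le_rfl
    rw [if_pos (by simp)] at e₁
    rw [if_neg (by simp)] at e₂
    have i₁ := ih.1.trans e₁.1
    refine ⟨i₁.trans e₂.1, ?_⟩
    rw [show 2 * (k + 1) = 2 * k + 1 + 1 by ring,
      ← intervalIntegral.integral_add_adjacent_intervals i₁ e₂.1,
      ← intervalIntegral.integral_add_adjacent_intervals ih.1 e₁.1, ih.2, e₁.2, e₂.2,
      show 2 * k + 1 + 1 = 2 * (k + 1) by ring]
    simp only [epoch_alternating_even, epoch_alternating_odd]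
    ring

/-- The right endpoint is included so that the odd case can start from it, and integrability is
recorded because adding adjacent integrals requires it. -/
theorem position_of_even {v₁ v₂ : ℝ} {j : Fin 2} {d : Fin 2 → ℕ → ℝ}
    (h : ∀ i, IsRegular (d i)) {k : ℕ} {s : ℝ}
    (h₁ : epoch (alternating j d) (2 * k) ≤ s) (h₂ : s ≤ epoch (alternating j d) (2 * k + 1)) :
    IntervalIntegrable (velocity v₁ v₂ j d) volume 0 s ∧
    position v₁ v₂ j d s =
      vel v₁ v₂ j * (s - epoch (d (j + 1)) k) + vel v₁ v₂ (j + 1) * epoch (d (j + 1)) k := by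
  have e₀ := integral_velocity_epoch v₁ v₂ j h k
  have e₁ := integral_velocity_of_mem_Icc (v₁ := v₁) (v₂ := v₂) h (2 * k) le_rfl h₁ h₂
  refine ⟨e₀.1.trans e₁.1, ?_⟩
  rw [position, ← intervalIntegral.integral_add_adjacent_intervals e₀.1 e₁.1, e₀.2, e₁.2,
    if_pos (by simp), epoch_alternating_even]
  ring

theorem position_of_odd {v₁ v₂ : ℝ} {j : Fin 2} {d : Fin 2 → ℕ → ℝ}
    (h : ∀ i, IsRegular (d i)) {k : ℕ} {s : ℝ}
    (h₁ : epoch (alternating j d) (2 * k + 1) ≤ s)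
    (h₂ : s ≤ epoch (alternating j d) (2 * k + 2)) :
    position v₁ v₂ j d s =
      vel v₁ v₂ j * epoch (d j) (k + 1) + vel v₁ v₂ (j + 1) * (s - epoch (d j) (k + 1)) := by
  have hE := IsRegular.alternating h j
  have e₀ := position_of_even (v₁ := v₁) (v₂ := v₂) h (k := k)
    (hE.strictMono (Nat.lt_add_one (2 * k))).le le_rfl
  have e₁ := integral_velocity_of_mem_Icc (v₁ := v₁) (v₂ := v₂) h (2 * k + 1) le_rfl h₁ h₂
  have e₂ := e₀.2
  rw [position] at e₂
  rw [position, ← intervalIntegral.integral_add_adjacent_intervals e₀.1 e₁.1, e₂, e₁.2,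
    if_neg (by simp), epoch_alternating_odd]
  ring

/-- The position at time `s` is determined by the time `T` spent with the initial velocity, which is
at least `y` if and only if the intermediate periods of the other velocity leave enough time. -/
theorem exists_position_eq (v₁ v₂ : ℝ) (j : Fin 2) {d : Fin 2 → ℕ → ℝ}
    (h : ∀ i, IsRegular (d i)) {s : ℝ} (hs : 0 ≤ s) :
    ∃ T, position v₁ v₂ j d s = vel v₁ v₂ j * T + vel v₁ v₂ (j + 1) * (s - T) ∧ 0 ≤ T ∧ T ≤ s ∧
      ∀ y, 0 < y → (y ≤ T ↔
        ∃ n, epoch (d j) n < y ∧ y ≤ epoch (d j) (n + 1) ∧ epoch (d (j + 1)) n ≤ s - y) := by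
  have hE := IsRegular.alternating h j
  have hA := (h j).strictMono.monotone
  have hB := (h (j + 1)).strictMono.monotone
  obtain ⟨m, hm₁, hm₂⟩ := hE.exists_mem_Ico hs
  obtain ⟨k, rfl | rfl⟩ := Nat.even_or_odd' m
  -- After `2 * k` changes the initial velocity is in force, and the other one has been used for
  -- exactly `k` full periods.
  · refine ⟨s - epoch (d (j + 1)) k, ?_, ?_, ?_, fun y hy => ?_⟩
    · rw [(position_of_even h hm₁ hm₂.le).2]
      ring
    all_goals rw [epoch_alternating_even] at hm₁; rw [epoch_alternating_odd] at hm₂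
    · linarith [(h j).epoch_nonneg k]
    · linarith [(h (j + 1)).epoch_nonneg k]
    · constructor
      · intro hT
        obtain ⟨n, hn₁, hn₂⟩ := (h j).exists_mem_Ioc hy
        refine ⟨n, hn₁, hn₂, ?_⟩
        have : n < k + 1 := (h j).strictMono.lt_iff_lt.1 (by linarith)
        linarith [hB (show n ≤ k by omega)]
      · rintro ⟨n, hn₁, hn₂, hn₃⟩
        rcases le_or_gt n k with hnk | hnk
        · rcases hnk.lt_or_eq with hnk | rfl
          · linarith [hA (show n + 1 ≤ k by omega)]
          · linarith
        · linarith [hA (show k + 1 ≤ n by omega), hB hnk.le]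
  -- After `2 * k + 1` changes the other velocity is in force, and the initial one has completed `k
  -- + 1` periods.
  · refine ⟨epoch (d j) (k + 1), position_of_odd h hm₁ hm₂.le, (h j).epoch_nonneg _, ?_,
      fun y hy => ?_⟩
    all_goals
      rw [epoch_alternating_odd] at hm₁
      rw [show 2 * k + 1 + 1 = 2 * (k + 1) by ring, epoch_alternating_even] at hm₂
    · linarith [(h (j + 1)).epoch_nonneg k]
    · constructor
      · intro hT
        obtain ⟨n, hn₁, hn₂⟩ := (h j).exists_mem_Ioc hy
        refine ⟨n, hn₁, hn₂, ?_⟩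
        have : n < k + 1 := (h j).strictMono.lt_iff_lt.1 (by linarith)
        linarith [hB (show n ≤ k by omega)]
      · rintro ⟨n, hn₁, hn₂, hn₃⟩
        rcases le_or_gt n k with hnk | hnk
        · linarith [hA (show n + 1 ≤ k + 1 by omega)]
        · linarith [hA (show k + 1 ≤ n by omega), hB (show k + 1 ≤ n by omega)]

section

open Set Filter Topology ENNReal

/-! ### Exponential distributions -/

theorem expMeasure_eq_withDensity (r : ℝ) :
    expMeasure r = volume.withDensity (exponentialPDF r) := rfl

theorem measurable_exponentialPDF (r : ℝ) : Measurable (exponentialPDF r) :=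
  (measurable_exponentialPDFReal r).ennreal_ofReal

theorem expMeasure_Iic {r : ℝ} (hr : 0 < r) (x : ℝ) :
    expMeasure r (Iic x) = ENNReal.ofReal (if 0 ≤ x then 1 - Real.exp (-(r * x)) else 0) := by
  rw [expMeasure_eq_withDensity, withDensity_apply _ measurableSet_Iic,
    lintegral_exponentialPDF_eq_antiDeriv hr]

theorem expMeasure_Ioi {r : ℝ} (hr : 0 < r) {x : ℝ} (hx : 0 ≤ x) :
    expMeasure r (Ioi x) = ENNReal.ofReal (Real.exp (-(r * x))) := by
  have := isProbabilityMeasure_expMeasure hr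
  have h₁ : Real.exp (-(r * x)) ≤ 1 := by
    have := mul_nonneg hr.le hx
    exact Real.exp_le_one_iff.2 (by linarith)
  rw [← compl_Iic, prob_compl_eq_one_sub measurableSet_Iic, expMeasure_Iic hr, if_pos hx,
    ← ENNReal.ofReal_one, ← ENNReal.ofReal_sub _ (by linarith)]
  congr 1
  ring

theorem expMeasure_Ici {r : ℝ} (hr : 0 < r) {x : ℝ} (hx : 0 ≤ x) :
    expMeasure r (Ici x) = ENNReal.ofReal (Real.exp (-(r * x))) := by
  rw [← expMeasure_Ioi hr hx]
  have : NullSingletonClass (expMeasure r) := by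
    rw [expMeasure_eq_withDensity]
    infer_instance
  exact measure_congr Ioi_ae_eq_Ici.symm

theorem ae_pos_expMeasure {r : ℝ} (hr : 0 < r) : ∀ᵐ x ∂expMeasure r, 0 < x := by
  rw [ae_iff]
  have : {x : ℝ | ¬ 0 < x} = Iic 0 := by ext; simp
  rw [this, expMeasure_Iic hr]
  simp

/-- Scaling separates the random intensity from the noise: a mixture of exponential laws becomes the
image of a product measure. -/
theorem map_div_expMeasure_one {r : ℝ} (hr : 0 < r) :
    (expMeasure 1).map (· / r) = expMeasure r := by
  have h₁ := isProbabilityMeasure_expMeasure one_pos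
  have := Measure.isProbabilityMeasure_map (μ := expMeasure 1) (f := (· / r)) (by fun_prop)
  refine Measure.ext_of_Iic _ _ fun x => ?_
  rw [Measure.map_apply (by fun_prop) measurableSet_Iic, expMeasure_Iic hr]
  have : (· / r) ⁻¹' Iic x = Iic (r * x) := by
    ext y; simp [div_le_iff₀ hr, mul_comm]
  rw [this, expMeasure_Iic one_pos, one_mul]
  simp [mul_nonneg_iff_of_pos_left hr]

/-- Tilting the standard exponential density by `e^{-cu}` gives `(1 + c)⁻¹` times the exponential
density of rate `1 + c`. -/
theorem lintegral_exp_neg_expMeasure_one {c : ℝ} (hc : 0 ≤ c) :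
    ∫⁻ u, ENNReal.ofReal (Real.exp (-(c * u))) ∂expMeasure 1 = ENNReal.ofReal (1 + c)⁻¹ := by
  rw [expMeasure_eq_withDensity, lintegral_withDensity_eq_lintegral_mul _
    (measurable_exponentialPDF 1) (by fun_prop)]
  have h : ∀ u, (exponentialPDF 1 * fun u => ENNReal.ofReal (Real.exp (-(c * u)))) u =
      ENNReal.ofReal (1 + c)⁻¹ * exponentialPDF (1 + c) u := by
    intro u
    rw [Pi.mul_apply, exponentialPDF_eq, exponentialPDF_eq, ← ENNReal.ofReal_mul' (by positivity),
      ← ENNReal.ofReal_mul (by positivity)]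
    congr 1
    split_ifs with hu
    · rw [inv_mul_cancel_left₀ (by positivity), mul_assoc, ← Real.exp_add]
      simp only [one_mul]
      congr 1
      ring
    · simp
  simp_rw [h]
  rw [lintegral_const_mul _ (measurable_exponentialPDF _),
    lintegral_exponentialPDF_eq_one (by positivity), mul_one]

theorem lintegral_prod_pi {n : ℕ} {μ : Measure ℝ} [IsProbabilityMeasure μ] {f : ℝ → ℝ≥0∞}
    (hf : Measurable f) :
    ∫⁻ u, ∏ k, f (u k) ∂(Measure.pi fun _ : Fin n => μ) = ∏ _k : Fin n, ∫⁻ x, f x ∂μ := by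
  rw [lintegral_prod_eq_prod_lintegral_of_indepFun Finset.univ
    (fun (k : Fin n) (u : Fin n → ℝ) => f (u k)) (iIndepFun_pi fun _ => hf.aemeasurable)
    fun k => hf.comp (measurable_pi_apply k)]
  exact Finset.prod_congr rfl fun k _ =>
    (measurePreserving_eval (fun _ : Fin n => μ) k).lintegral_comp hf

/-! ### The epochs of a geometric counting process -/

variable {Ω : Type*} [MeasurableSpace Ω] {P : Measure Ω} {lam : ℝ} {D : ℕ → Ω → ℝ}

/-- The first `n` intertimes are standard exponential variables divided by the intensity. -/
theorem IsGCPIntertimes.map_eq [IsProbabilityMeasure P] (hlam : 0 < lam)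
    (hD : IsGCPIntertimes P lam D) (n : ℕ) :
    P.map (fun ω (k : Fin n) => D k ω) =
      ((expMeasure lam⁻¹).prod (Measure.pi fun _ : Fin n => expMeasure 1)).map
        (fun p k => p.2 k / p.1) := by
  have hl : 0 < lam⁻¹ := inv_pos.2 hlam
  have h₁ := isProbabilityMeasure_expMeasure one_pos
  have h₂ := isProbabilityMeasure_expMeasure hl
  have hm : Measurable fun ω (k : Fin n) => D k ω := measurable_pi_lambda _ fun k => hD.measurable k
  have hm' : Measurable fun (p : ℝ × (Fin n → ℝ)) k => p.2 k / p.1 := by fun_prop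
  have := Measure.isProbabilityMeasure_map (μ := P) hm.aemeasurable
  refine ext_of_generate_finite _ generateFrom_pi.symm isPiSystem_pi ?_ ?_
  · rintro _ ⟨B, hB, rfl⟩
    replace hB : ∀ k, MeasurableSet (B k) := fun k => hB k (mem_univ k)
    have hBm : MeasurableSet (univ.pi B) := MeasurableSet.univ_pi hB
    rw [Measure.map_apply hm hBm, Measure.map_apply hm' hBm, Measure.prod_apply (hm' hBm)]
    -- The law is stated for sequences of sets indexed by `ℕ`; the sides of the box are padded with
    -- `univ`.
    have := hD.law n (fun k => if h : k < n then B ⟨k, h⟩ else univ) (fun k => by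
      split_ifs <;> simp [hB])
    have hset : (fun ω (k : Fin n) => D k ω) ⁻¹' univ.pi B =
        {ω | ∀ k < n, D k ω ∈ if h : k < n then B ⟨k, h⟩ else univ} := by
      ext ω
      simp only [mem_preimage, mem_univ_pi, mem_ofPred_eq]
      constructor
      · intro h k hk
        rw [dif_pos hk]
        exact h ⟨k, hk⟩
      · intro h k
        have := h k k.2
        rwa [dif_pos k.2] at this
    rw [hset, this]
    refine lintegral_congr_ae ?_
    filter_upwards [ae_pos_expMeasure hl] with α hα
    have hset' : Prod.mk α ⁻¹' ((fun (p : ℝ × (Fin n → ℝ)) k => p.2 k / p.1) ⁻¹' univ.pi B) =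
        univ.pi fun k => (· / α) ⁻¹' B k := by
      ext u; simp
    rw [hset', Measure.pi_pi, Finset.prod_range]
    refine Finset.prod_congr rfl fun k _ => ?_
    rw [dif_pos k.2, ← map_div_expMeasure_one hα, Measure.map_apply (by fun_prop) (hB k)]
  · rw [Measure.map_apply hm .univ, Measure.map_apply hm' .univ]
    simp

/-- The intensity is integrated first. With standard exponential `u k`, the event reads `α ≥ (∑ u k)
/ z`, of probability `exp (-(∑ u k) / (lam * z))`; this factors over `k`, and each factor has mean
`(1 + (lam * z)⁻¹)⁻¹ = lam * z / (1 + lam * z)`. -/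
theorem IsGCPIntertimes.measure_epoch_le_of_pos [IsProbabilityMeasure P] (hlam : 0 < lam)
    (hD : IsGCPIntertimes P lam D) (n : ℕ) {z : ℝ} (hz : 0 < z) :
    P {ω | epoch (fun k => D k ω) n ≤ z} = ENNReal.ofReal ((lam * z / (1 + lam * z)) ^ n) := by
  have hl : 0 < lam⁻¹ := inv_pos.2 hlam
  have h₁ := isProbabilityMeasure_expMeasure one_pos
  have h₂ := isProbabilityMeasure_expMeasure hl
  have hm : Measurable fun ω (k : Fin n) => D k ω := measurable_pi_lambda _ fun k => hD.measurable k
  have hm' : Measurable fun (p : ℝ × (Fin n → ℝ)) k => p.2 k / p.1 := by fun_prop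
  have hS : MeasurableSet {u : Fin n → ℝ | ∑ k, u k ≤ z} :=
    measurableSet_le (by fun_prop) measurable_const
  have hset : {ω | epoch (fun k => D k ω) n ≤ z} =
      (fun ω (k : Fin n) => D k ω) ⁻¹' {u : Fin n → ℝ | ∑ k, u k ≤ z} := by
    ext ω
    simp [epoch, Finset.sum_range]
  rw [hset, ← Measure.map_apply hm hS, hD.map_eq hlam, Measure.map_apply hm' hS,
    Measure.prod_apply_symm (hm' hS)]
  have hpos : ∀ᵐ u ∂(Measure.pi fun _ : Fin n => expMeasure 1), ∀ k, 0 < u k :=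
    ae_all_iff.2 fun k =>
      (measurePreserving_eval (fun _ : Fin n => expMeasure 1) k).quasiMeasurePreserving.ae
        (ae_pos_expMeasure one_pos)
  have hc : 0 < (lam * z)⁻¹ := by positivity
  calc ∫⁻ u, expMeasure lam⁻¹ ((fun x => (x, u)) ⁻¹'
        ((fun (p : ℝ × (Fin n → ℝ)) k => p.2 k / p.1) ⁻¹' {u : Fin n → ℝ | ∑ k, u k ≤ z}))
          ∂(Measure.pi fun _ : Fin n => expMeasure 1)
      = ∫⁻ u, ∏ k, ENNReal.ofReal (Real.exp (-((lam * z)⁻¹ * u k)))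
          ∂(Measure.pi fun _ : Fin n => expMeasure 1) := by
        refine lintegral_congr_ae ?_
        filter_upwards [hpos] with u hu
        have hsum : 0 ≤ ∑ k, u k := Finset.sum_nonneg fun k _ => (hu k).le
        rw [← ENNReal.ofReal_prod_of_nonneg (fun _ _ => (Real.exp_pos _).le), ← Real.exp_sum,
          Finset.sum_neg_distrib, ← Finset.mul_sum,
          show (lam * z)⁻¹ * ∑ k, u k = lam⁻¹ * ((∑ k, u k) / z) by field_simp,
          ← expMeasure_Ici hl (by positivity)]
        refine measure_congr ?_
        filter_upwards [ae_pos_expMeasure hl] with α hα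
        simp only [eq_iff_iff]
        change ∑ k, u k / α ≤ z ↔ (∑ k, u k) / z ≤ α
        rw [← Finset.sum_div, div_le_iff₀ hα, div_le_iff₀ hz, mul_comm]
    _ = ∏ _k : Fin n, ∫⁻ u, ENNReal.ofReal (Real.exp (-((lam * z)⁻¹ * u))) ∂expMeasure 1 :=
        lintegral_prod_pi (f := fun u => ENNReal.ofReal (Real.exp (-((lam * z)⁻¹ * u))))
          (by fun_prop)
    _ = _ := by
        rw [lintegral_exp_neg_expMeasure_one hc.le, Finset.prod_const, Finset.card_univ,
          Fintype.card_fin, ENNReal.ofReal_pow (by positivity)]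
        congr 2
        field_simp
        ring

theorem continuousAt_geometric_tail (hlam : 0 < lam) (n : ℕ) {z : ℝ} (hz : 0 ≤ z) :
    ContinuousAt (fun z => ENNReal.ofReal ((lam * z / (1 + lam * z)) ^ n)) z := by
  have : 1 + lam * z ≠ 0 := by positivity
  refine ENNReal.continuous_ofReal.continuousAt.comp ?_
  fun_prop (disch := assumption)

theorem IsGCPIntertimes.measure_epoch_le [IsProbabilityMeasure P] (hlam : 0 < lam)
    (hD : IsGCPIntertimes P lam D) (n : ℕ) {z : ℝ} (hz : 0 ≤ z) :
    P {ω | epoch (fun k => D k ω) n ≤ z} = ENNReal.ofReal ((lam * z / (1 + lam * z)) ^ n) := by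
  rcases hz.lt_or_eq with hz | rfl
  · exact hD.measure_epoch_le_of_pos hlam n hz
  rcases Nat.eq_zero_or_pos n with rfl | hn
  · simp [epoch_zero]
  -- At `z = 0` with `n > 0` the value is `0`, and monotonicity with the limit from the right forces
  -- the probability down to it.
  have ht : Tendsto (fun z => ENNReal.ofReal ((lam * z / (1 + lam * z)) ^ n)) (𝓝[>] 0)
      (𝓝 (ENNReal.ofReal ((lam * 0 / (1 + lam * 0)) ^ n))) :=
    (continuousAt_geometric_tail hlam n le_rfl).tendsto.mono_left nhdsWithin_le_nhds
  refine le_antisymm (ge_of_tendsto ht ?_) (by simp [hn.ne'])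
  filter_upwards [self_mem_nhdsWithin] with z hz
  rw [← hD.measure_epoch_le_of_pos hlam n hz]
  exact measure_mono fun ω hω => le_trans (α := ℝ) hω (le_of_lt hz)

/-- The distribution function is continuous at `z > 0`, so the limit from the left shows that strict
and weak inequalities have the same probability. -/
theorem IsGCPIntertimes.measure_epoch_lt [IsProbabilityMeasure P] (hlam : 0 < lam)
    (hD : IsGCPIntertimes P lam D) (n : ℕ) {z : ℝ} (hz : 0 < z) :
    P {ω | epoch (fun k => D k ω) n < z} = ENNReal.ofReal ((lam * z / (1 + lam * z)) ^ n) := by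
  have ht : Tendsto (fun z => ENNReal.ofReal ((lam * z / (1 + lam * z)) ^ n)) (𝓝[<] z)
      (𝓝 (ENNReal.ofReal ((lam * z / (1 + lam * z)) ^ n))) :=
    (continuousAt_geometric_tail hlam n hz.le).tendsto.mono_left nhdsWithin_le_nhds
  refine le_antisymm ?_ (le_of_tendsto ht ?_)
  · rw [← hD.measure_epoch_le_of_pos hlam n hz]
    exact measure_mono fun ω hω => le_of_lt (α := ℝ) hω
  · filter_upwards [Ioo_mem_nhdsLT hz] with w hw
    rw [← hD.measure_epoch_le_of_pos hlam n hw.1]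
    exact measure_mono fun ω hω => lt_of_le_of_lt (α := ℝ) hω hw.2

theorem IsGCPIntertimes.ae_pos [IsProbabilityMeasure P] (hlam : 0 < lam)
    (hD : IsGCPIntertimes P lam D) (k : ℕ) : ∀ᵐ ω ∂P, 0 < D k ω := by
  have hl : 0 < lam⁻¹ := inv_pos.2 hlam
  have h := hD.law (k + 1) (fun i => if i = k then Iic 0 else univ) fun i => by
    split_ifs <;> simp [measurableSet_Iic]
  rw [ae_iff]
  refine measure_mono_null (t := {ω | ∀ i < k + 1, D i ω ∈ if i = k then Iic 0 else univ})
    (fun ω hω i _ => ?_) ?_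
  · split_ifs with hi
    · subst hi
      simpa using hω
    · trivial
  · rw [h, lintegral_congr_ae (g := 0), Pi.zero_def, lintegral_zero]
    filter_upwards [ae_pos_expMeasure hl] with α hα
    refine Finset.prod_eq_zero (Finset.self_mem_range_succ k) ?_
    simp [expMeasure_Iic hα]

/-- The bound `p` is kept abstract to serve two cases: a geometric power for a GCP, and the terms of
a convergent series for the resets. -/
theorem ae_unbounded_epoch {p : ℝ → ℕ → ℝ≥0∞} (hp : ∀ z > 0, Tendsto (p z) atTop (𝓝 0))
    (h : ∀ z > 0, ∀ n, P {ω | epoch (fun k => D k ω) n ≤ z} ≤ p z n) :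
    ∀ᵐ ω ∂P, ∀ t, ∃ n, t < epoch (fun k => D k ω) n := by
  have key : ∀ N : ℕ, ∀ᵐ ω ∂P, ∃ n, (N + 1 : ℝ) < epoch (fun k => D k ω) n := by
    intro N
    have hN : (0 : ℝ) < N + 1 := by positivity
    rw [ae_iff]
    refine le_antisymm (ge_of_tendsto' (hp _ hN) fun n => ?_) zero_le
    refine le_trans (measure_mono fun ω hω => ?_) (h _ hN n)
    simp only [not_exists, not_lt, mem_ofPred_eq] at hω ⊢
    exact hω n
  filter_upwards [ae_all_iff.2 key] with ω hω t
  obtain ⟨N, hN⟩ := exists_nat_ge t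
  obtain ⟨n, hn⟩ := hω N
  exact ⟨n, by linarith⟩

theorem IsGCPIntertimes.ae_isRegular [IsProbabilityMeasure P] (hlam : 0 < lam)
    (hD : IsGCPIntertimes P lam D) : ∀ᵐ ω ∂P, IsRegular fun k => D k ω := by
  have hu : ∀ᵐ ω ∂P, ∀ t, ∃ n, t < epoch (fun k => D k ω) n := by
    refine ae_unbounded_epoch (fun z hz => ?_)
      fun z hz n => (hD.measure_epoch_le hlam n (le_of_lt hz)).le
    rw [← ENNReal.ofReal_zero]
    have hz' : 0 < z := hz
    refine ENNReal.tendsto_ofReal (tendsto_pow_atTop_nhds_zero_of_lt_one (by positivity) ?_)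
    rw [div_lt_one (by positivity)]
    linarith
  filter_upwards [ae_all_iff.2 (hD.ae_pos hlam), hu] with ω h₁ h₂
  exact ⟨h₁, h₂⟩

end

section

open Set Filter Topology ENNReal

/-! ### The law of the motion without resets -/

variable {Ω : Type*} [MeasurableSpace Ω] {P : Measure Ω} {lam : ℝ}

/-- The law of the time spent with the initial velocity, among the first `s` units of time. -/
def occupationLaw (lam s : ℝ) : Measure ℝ :=
  ENNReal.ofReal (1 / (1 + lam * s)) • Measure.dirac s +
    ENNReal.ofReal (lam / (1 + lam * s)) • volume.restrict (Ioo 0 s)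

/-- The law of the position at time `s` of the motion with initial velocity of index `j`. -/
def motionLaw (v₁ v₂ lam : ℝ) (j : Fin 2) (s : ℝ) : Measure ℝ :=
  ENNReal.ofReal (1 / (1 + lam * s)) • Measure.dirac (vel v₁ v₂ j * s) +
    ENNReal.ofReal (lam / ((v₁ - v₂) * (1 + lam * s))) • volume.restrict (Ioo (v₂ * s) (v₁ * s))

theorem occupationLaw_Ici (hlam : 0 < lam) {s y : ℝ} (hy : 0 < y) (hys : y ≤ s) :
    occupationLaw lam s (Ici y) = ENNReal.ofReal ((1 + lam * (s - y)) / (1 + lam * s)) := by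
  have h : Ici y ∩ Ioo 0 s = Ico y s := by
    ext x
    simp only [mem_inter_iff, mem_Ici, mem_Ioo, mem_Ico]
    exact ⟨fun h => ⟨h.1, h.2.2⟩, fun h => ⟨h.1, hy.trans_le h.1, h.2⟩⟩
  have hs : 0 < s := hy.trans_le hys
  rw [occupationLaw, Measure.add_apply, Measure.smul_apply, Measure.smul_apply,
    Measure.dirac_apply' _ measurableSet_Ici, Measure.restrict_apply measurableSet_Ici, h,
    Real.volume_Ico, indicator_of_mem (by exact hys), Pi.one_apply, smul_eq_mul, smul_eq_mul,
    mul_one, ← ENNReal.ofReal_mul (by positivity), ← ENNReal.ofReal_add (by positivity)]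
  · congr 1
    field_simp
  · exact mul_nonneg (by positivity) (by linarith)

theorem occupationLaw_Ici_of_nonpos (hlam : 0 < lam) {s y : ℝ} (hs : 0 ≤ s) (hy : y ≤ 0) :
    occupationLaw lam s (Ici y) = 1 := by
  have h : Ici y ∩ Ioo 0 s = Ioo 0 s :=
    inter_eq_right.2 fun x hx => hy.trans hx.1.le
  rw [occupationLaw, Measure.add_apply, Measure.smul_apply, Measure.smul_apply,
    Measure.dirac_apply' _ measurableSet_Ici, Measure.restrict_apply measurableSet_Ici, h,
    Real.volume_Ioo, indicator_of_mem (by exact hy.trans hs), Pi.one_apply, smul_eq_mul,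
    smul_eq_mul, mul_one, ← ENNReal.ofReal_mul (by positivity),
    ← ENNReal.ofReal_add (by positivity), ← ENNReal.ofReal_one]
  · congr 1
    field_simp
    ring
  · exact mul_nonneg (by positivity) (by linarith)

theorem occupationLaw_Ici_of_lt {s y : ℝ} (hy : s < y) :
    occupationLaw lam s (Ici y) = 0 := by
  have h : Ici y ∩ Ioo 0 s = ∅ := by
    ext x
    simp only [mem_inter_iff, mem_Ici, mem_Ioo, mem_empty_iff_false, iff_false]
    rintro ⟨h₁, h₂, h₃⟩
    linarith
  rw [occupationLaw, Measure.add_apply, Measure.smul_apply, Measure.smul_apply,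
    Measure.dirac_apply' _ measurableSet_Ici, Measure.restrict_apply measurableSet_Ici, h,
    indicator_of_notMem (by simpa using hy)]
  simp

/-- Two independent geometric counting processes: the second one has, by time `z`, at least as many
epochs as the first one has before time `y`. -/
theorem IsGCPIntertimes.measure_exists_epoch [IsProbabilityMeasure P] (hlam : 0 < lam)
    {A B : ℕ → Ω → ℝ} (hA : IsGCPIntertimes P lam A) (hB : IsGCPIntertimes P lam B)
    (hAB : IndepFun (fun ω k => A k ω) (fun ω k => B k ω) P) {y z : ℝ} (hy : 0 < y) (hz : 0 ≤ z) :
    P {ω | ∃ n, epoch (fun k => A k ω) n < y ∧ y ≤ epoch (fun k => A k ω) (n + 1) ∧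
        epoch (fun k => B k ω) n ≤ z} =
      ENNReal.ofReal ((1 + lam * z) / (1 + lam * (y + z))) := by
  have hAm : Measurable fun ω k => A k ω := measurable_pi_lambda _ hA.measurable
  have hBm : Measurable fun ω k => B k ω := measurable_pi_lambda _ hB.measurable
  set a := lam * y / (1 + lam * y) with ha
  set b := lam * z / (1 + lam * z) with hb
  have ha₀ : 0 ≤ a := by positivity
  have hb₀ : 0 ≤ b := by positivity
  have ha₁ : a < 1 := by rw [ha, div_lt_one (by positivity)]; linarith
  have hb₁ : b < 1 := by rw [hb, div_lt_one (by positivity)]; linarith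
  have hab : a * b < 1 := by nlinarith
  let S : ℕ → Set (ℕ → ℝ) := fun n => {d | epoch d n < y ∧ y ≤ epoch d (n + 1)}
  let T : ℕ → Set (ℕ → ℝ) := fun n => {d | epoch d n ≤ z}
  have hS : ∀ n, MeasurableSet (S n) := fun n =>
    (measurableSet_lt (measurable_epoch n) measurable_const).inter
      (measurableSet_le measurable_const (measurable_epoch (n + 1)))
  have hT : ∀ n, MeasurableSet (T n) := fun n =>
    measurableSet_le (measurable_epoch n) measurable_const
  let E : ℕ → Set Ω := fun n => ((fun ω k => A k ω) ⁻¹' S n) ∩ ((fun ω k => B k ω) ⁻¹' T n)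
  have hE : ∀ n, MeasurableSet (E n) := fun n => (hAm (hS n)).inter (hBm (hT n))
  have hset : {ω | ∃ n, epoch (fun k => A k ω) n < y ∧ y ≤ epoch (fun k => A k ω) (n + 1) ∧
        epoch (fun k => B k ω) n ≤ z} = ⋃ n, E n := by
    ext ω
    simp [E, S, T, and_assoc]
  have hreg := hA.ae_isRegular hlam
  -- At most one `n` has `y` between its consecutive epochs, but only where the epochs are strictly
  -- increasing, hence disjointness up to a null set.
  have hdisj : Pairwise (Function.onFun (AEDisjoint P) E) := by
    intro m n hmn
    refine measure_mono_null (t := {ω | ¬ IsRegular fun k => A k ω}) ?_ (ae_iff.1 hreg)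
    rintro ω ⟨⟨⟨h₁, h₂⟩, -⟩, ⟨⟨h₃, h₄⟩, -⟩⟩ hω
    have l₁ := hω.strictMono.lt_iff_lt.1 (h₁.trans_le h₄)
    have l₂ := hω.strictMono.lt_iff_lt.1 (h₃.trans_le h₂)
    omega
  have hPS : ∀ n, P ((fun ω k => A k ω) ⁻¹' S n) = ENNReal.ofReal (a ^ n - a ^ (n + 1)) := by
    intro n
    have h₁ := hA.measure_epoch_lt hlam n hy
    have h₂ := hA.measure_epoch_lt hlam (n + 1) hy
    rw [← ha] at h₁ h₂
    rw [ENNReal.ofReal_sub _ (by positivity), ← h₁, ← h₂]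
    have hm : MeasurableSet {ω | epoch (fun k => A k ω) (n + 1) < y} :=
      measurableSet_lt ((measurable_epoch (n + 1)).comp hAm) measurable_const
    have hsub : {ω | epoch (fun k => A k ω) (n + 1) < y} ≤ᵐ[P]
        {ω | epoch (fun k => A k ω) n < y} := by
      filter_upwards [hreg] with ω hω h
      exact lt_trans (hω.strictMono (Nat.lt_add_one n)) h
    have h₃ : P ({ω | epoch (fun k => A k ω) n < y} ∩ {ω | epoch (fun k => A k ω) (n + 1) < y}) =
        P {ω | epoch (fun k => A k ω) (n + 1) < y} := by
      refine measure_congr ?_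
      filter_upwards [hsub] with ω h
      exact propext ⟨fun h' => h'.2, fun h' => ⟨h h', h'⟩⟩
    have h₄ : (fun ω k => A k ω) ⁻¹' S n =
        {ω | epoch (fun k => A k ω) n < y} \ {ω | epoch (fun k => A k ω) (n + 1) < y} := by
      ext ω
      simp [S]
    rw [h₄]
    refine ENNReal.eq_sub_of_add_eq (measure_ne_top _ _) ?_
    rw [add_comm, ← h₃]
    exact measure_inter_add_sdiff _ hm
  have hPT : ∀ n, P ((fun ω k => B k ω) ⁻¹' T n) = ENNReal.ofReal (b ^ n) := fun n =>
    hB.measure_epoch_le hlam n hz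
  rw [hset, measure_iUnion₀ hdisj fun n => (hE n).nullMeasurableSet]
  -- Independence gives `(a ^ n - a ^ (n + 1)) * b ^ n`, so the total is `(1 - a) / (1 - a * b)`.
  have hPE : ∀ n, P (E n) = ENNReal.ofReal ((1 - a) * (a * b) ^ n) := by
    intro n
    rw [hAB.measure_inter_preimage_eq_mul _ _ (hS n) (hT n), hPS, hPT,
      ← ENNReal.ofReal_mul' (by positivity)]
    congr 1
    ring
  simp_rw [hPE]
  rw [← ENNReal.ofReal_tsum_of_nonneg (fun n => mul_nonneg (by linarith) (by positivity))
    ((summable_geometric_of_lt_one (by positivity) hab).mul_left _), tsum_mul_left,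
    tsum_geometric_of_lt_one (by positivity) hab]
  congr 1
  have h₁ : 1 - a = 1 / (1 + lam * y) := by rw [ha]; field_simp; ring
  have h₂ : 1 - a * b = (1 + lam * (y + z)) / ((1 + lam * y) * (1 + lam * z)) := by
    rw [ha, hb]; field_simp; ring
  rw [h₁, h₂]
  field_simp

/-- For either `j` the map has slope `±(v₁ - v₂)` and matches `(0, s)` with `(v₂ s, v₁ s)`; the
sign, the only trace of `j`, is lost in the Jacobian. -/
theorem map_affine_restrict_volume {v₁ v₂ s : ℝ} (hv : v₂ < v₁) (j : Fin 2) :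
    (volume.restrict (Ioo 0 s)).map (fun x => vel v₁ v₂ j * x + vel v₁ v₂ (j + 1) * (s - x)) =
      ENNReal.ofReal (1 / (v₁ - v₂)) • volume.restrict (Ioo (v₂ * s) (v₁ * s)) := by
  ext E hE
  set c := vel v₁ v₂ j - vel v₁ v₂ (j + 1) with hc
  have hcabs : |c| = v₁ - v₂ := by
    fin_cases j
    · simp only [hc, vel]; simp [abs_of_pos (sub_pos.2 hv)]
    · simp only [hc, vel]; simp [abs_of_neg (sub_neg.2 hv)]
  have hc₀ : c ≠ 0 := by rw [← abs_pos, hcabs]; linarith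
  have hf : (fun x => vel v₁ v₂ j * x + vel v₁ v₂ (j + 1) * (s - x)) =
      (· + vel v₁ v₂ (j + 1) * s) ∘ (c * ·) := by
    ext x; simp [hc]; ring
  have hI : (fun x => vel v₁ v₂ j * x + vel v₁ v₂ (j + 1) * (s - x)) ⁻¹'
      Ioo (v₂ * s) (v₁ * s) = Ioo 0 s := by
    ext x
    have h₀ : 0 < v₁ - v₂ := sub_pos.2 hv
    have e₁ : (0 < x) ↔ 0 < (v₁ - v₂) * x := (mul_pos_iff_of_pos_left h₀).symm
    have e₂ : (x < s) ↔ 0 < (v₁ - v₂) * (s - x) := by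
      rw [mul_pos_iff_of_pos_left h₀, sub_pos]
    simp only [mem_preimage, mem_Ioo]
    rw [e₁, e₂]
    fin_cases j
    · simp [vel]
      constructor <;> rintro ⟨h₁, h₂⟩ <;> constructor <;> nlinarith
    · simp [vel]
      constructor <;> rintro ⟨h₁, h₂⟩ <;> constructor <;> nlinarith
  rw [Measure.map_apply (by fun_prop) hE, Measure.restrict_apply (hE.preimage (by fun_prop)), ← hI,
    ← preimage_inter, hf, preimage_comp, Real.volume_preimage_mul_left hc₀,
    measure_preimage_add_right, Measure.smul_apply, Measure.restrict_apply hE, smul_eq_mul, abs_inv,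
    hcabs, one_div]

theorem map_occupationLaw {v₁ v₂ s : ℝ} (hv : v₂ < v₁) (hlam : 0 < lam) (hs : 0 ≤ s) (j : Fin 2) :
    (occupationLaw lam s).map (fun x => vel v₁ v₂ j * x + vel v₁ v₂ (j + 1) * (s - x)) =
      motionLaw v₁ v₂ lam j s := by
  rw [occupationLaw, motionLaw, Measure.map_add _ _ (by fun_prop), Measure.map_smul,
    Measure.map_smul, map_affine_restrict_volume hv, Measure.map_dirac' (by fun_prop), smul_smul,
    ← ENNReal.ofReal_mul (by positivity)]
  have : 0 < v₁ - v₂ := sub_pos.2 hv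
  congr 3
  · simp
  · field_simp

/-- The law of the position at time `s` of the motion driven by two independent geometric counting
processes. -/
theorem map_position [IsProbabilityMeasure P] {v₁ v₂ : ℝ} (hv : v₂ < v₁) (hlam : 0 < lam)
    {D : Fin 2 → ℕ → Ω → ℝ} (hD : ∀ i, IsGCPIntertimes P lam (D i))
    (hind : IndepFun (fun ω k => D 0 k ω) (fun ω k => D 1 k ω) P) (j : Fin 2) {s : ℝ}
    (hs : 0 ≤ s) :
    P.map (fun ω => position v₁ v₂ j (fun i k => D i k ω) s) = motionLaw v₁ v₂ lam j s := by
  have hDm : Measurable fun ω => (fun (i : Fin 2) k => D i k ω, s) :=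
    (measurable_pi_lambda _ fun i => measurable_pi_lambda _ fun k =>
      (hD i).measurable k).prodMk measurable_const
  have hpos := (measurable_position v₁ v₂ j).comp hDm
  have hind' : IndepFun (fun ω k => D j k ω) (fun ω k => D (j + 1) k ω) P := by
    fin_cases j
    · exact hind
    · exact hind.symm
  have hc₀ : vel v₁ v₂ j - vel v₁ v₂ (j + 1) ≠ 0 := by
    fin_cases j
    · simp [vel]; linarith
    · simp [vel]; linarith
  -- Solving the affine relation for the occupation time gives a measurable function defined
  -- everywhere, equal almost surely to the `T` of `exists_position_eq`.
  set τ : Ω → ℝ := fun ω => (position v₁ v₂ j (fun i k => D i k ω) s - vel v₁ v₂ (j + 1) * s) /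
    (vel v₁ v₂ j - vel v₁ v₂ (j + 1)) with hτ
  have hτm : Measurable τ := (Measurable.sub_const hpos _).div_const _
  have hreg : ∀ᵐ ω ∂P, ∀ i, IsRegular fun k => D i k ω :=
    ae_all_iff.2 fun i => (hD i).ae_isRegular hlam
  have hprop : ∀ᵐ ω ∂P, 0 ≤ τ ω ∧ τ ω ≤ s ∧ ∀ y, 0 < y → (y ≤ τ ω ↔
      ∃ n, epoch (fun k => D j k ω) n < y ∧ y ≤ epoch (fun k => D j k ω) (n + 1) ∧
        epoch (fun k => D (j + 1) k ω) n ≤ s - y) := by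
    filter_upwards [hreg] with ω hω
    obtain ⟨T, hT, h⟩ := exists_position_eq v₁ v₂ j hω hs
    have : τ ω = T := by
      rw [hτ]
      simp only
      rw [hT]
      field_simp
      ring
    rwa [this]
  have hlaw : P.map τ = occupationLaw lam s := by
    have := Measure.isProbabilityMeasure_map (μ := P) hτm.aemeasurable
    refine Measure.ext_of_Ici _ _ fun y => ?_
    rw [Measure.map_apply hτm measurableSet_Ici]
    rcases le_or_gt y 0 with hy | hy
    · rw [occupationLaw_Ici_of_nonpos hlam hs hy, ← measure_univ (μ := P)]
      refine measure_congr ?_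
      filter_upwards [hprop] with ω hω
      exact propext ⟨fun _ => trivial, fun _ => hy.trans hω.1⟩
    rcases le_or_gt y s with hys | hys
    · rw [occupationLaw_Ici hlam hy hys]
      have h := IsGCPIntertimes.measure_exists_epoch hlam (hD j) (hD (j + 1)) hind' hy
        (sub_nonneg.2 hys)
      rw [add_sub_cancel] at h
      rw [← h]
      refine measure_congr ?_
      filter_upwards [hprop] with ω hω
      exact propext (hω.2.2 y hy)
    · rw [occupationLaw_Ici_of_lt hys]
      refine measure_mono_null (t := {ω | ¬ τ ω ≤ s}) (fun ω hω => ?_) (ae_iff.1 ?_)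
      · have : y ≤ τ ω := hω
        simp; linarith
      · filter_upwards [hprop] with ω hω using hω.2.1
  rw [← map_occupationLaw hv hlam hs, ← hlaw, Measure.map_map (by fun_prop) hτm]
  congr 1
  ext ω
  simp only [Function.comp, hτ]
  field_simp
  ring

end

section

open Set Filter Topology ENNReal

/-! ### The time since the last reset -/

variable {Ω : Type*} [MeasurableSpace Ω] {P : Measure Ω}

theorem lintegral_comp_prodMk_of_indepFun [IsProbabilityMeasure P] {α β : Type*}
    [MeasurableSpace α] [MeasurableSpace β] {X : Ω → α} {Y : Ω → β} (hX : Measurable X)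
    (hY : Measurable Y) (h : IndepFun X Y P) {F : α × β → ℝ≥0∞} (hF : Measurable F) :
    ∫⁻ ω, F (X ω, Y ω) ∂P = ∫⁻ ω, ∫⁻ ω', F (X ω, Y ω') ∂P ∂P := by
  have := Measure.isProbabilityMeasure_map (μ := P) hX.aemeasurable
  have := Measure.isProbabilityMeasure_map (μ := P) hY.aemeasurable
  rw [← lintegral_map (f := F) (g := fun ω => (X ω, Y ω)) hF (hX.prodMk hY),
    (indepFun_iff_map_prod_eq_prod_map_map hX.aemeasurable hY.aemeasurable).1 h,
    lintegral_prod _ hF.aemeasurable, lintegral_map (hF.lintegral_prod_right') hX]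
  refine lintegral_congr fun ω => ?_
  rw [lintegral_map (f := fun y => F (X ω, y)) (hF.comp measurable_prodMk_left) hY]

/-- The density of the `n + 1`-st epoch of a Poisson process. -/
def erlangPDF (ξ : ℝ) (n : ℕ) (u : ℝ) : ℝ≥0∞ :=
  (Ioi 0).indicator
    (fun u => ENNReal.ofReal (ξ ^ (n + 1) * u ^ n / n.factorial * Real.exp (-(ξ * u)))) u

@[fun_prop]
theorem measurable_erlangPDF (ξ : ℝ) (n : ℕ) : Measurable (erlangPDF ξ n) :=
  Measurable.indicator (by fun_prop) measurableSet_Ioi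

theorem lintegral_expMeasure (ξ : ℝ) {f : ℝ → ℝ≥0∞} (hf : Measurable f) :
    ∫⁻ x, f x ∂expMeasure ξ = ∫⁻ x, erlangPDF ξ 0 x * f x := by
  rw [expMeasure_eq_withDensity, lintegral_withDensity_eq_lintegral_mul _
    (measurable_exponentialPDF ξ) hf]
  refine lintegral_congr_ae ?_
  -- The two densities disagree at the origin, where `exponentialPDF` has the value `ξ` and
  -- `erlangPDF` vanishes.
  filter_upwards [Measure.ae_ne volume 0] with x hx
  rw [Pi.mul_apply, erlangPDF, exponentialPDF_eq]
  rcases hx.lt_or_gt with h | h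
  · rw [if_neg h.not_ge, indicator_of_notMem (by simpa using h.le), ENNReal.ofReal_zero]
  · rw [if_pos h.le, indicator_of_mem (by simpa using h)]
    simp

/-- The exponential series of `ξ * u` cancels `e^{-ξu}`: the renewal density of a Poisson process is
constant. -/
theorem tsum_erlangPDF {ξ : ℝ} (hξ : 0 < ξ) (u : ℝ) :
    ∑' n, erlangPDF ξ n u = (Ioi 0).indicator (fun _ => ENNReal.ofReal ξ) u := by
  by_cases hu : u ∈ Ioi (0 : ℝ)
  · simp only [erlangPDF, indicator_of_mem hu]
    have hu' : 0 < u := hu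
    have h : HasSum (fun n : ℕ => ξ ^ (n + 1) * u ^ n / n.factorial * Real.exp (-(ξ * u))) ξ := by
      have h₁ := ((NormedSpace.expSeries_div_hasSum_exp (𝔸 := ℝ) (ξ * u)).mul_left ξ).mul_right
        (Real.exp (-(ξ * u)))
      rw [← Real.exp_eq_exp_ℝ, mul_assoc, ← Real.exp_add, add_neg_cancel, Real.exp_zero,
        mul_one] at h₁
      have h₂ : (fun n : ℕ => ξ ^ (n + 1) * u ^ n / n.factorial * Real.exp (-(ξ * u))) =
          fun n : ℕ => ξ * ((ξ * u) ^ n / n.factorial) * Real.exp (-(ξ * u)) := by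
        ext n
        rw [mul_pow]
        ring
      rw [h₂]
      exact h₁
    rw [← ENNReal.ofReal_tsum_of_nonneg (fun n => by positivity) h.summable, h.tsum_eq]
  · simp [erlangPDF, indicator_of_notMem hu]

theorem lintegral_erlangPDF_mul {ξ : ℝ} (hξ : 0 < ξ) (n : ℕ) (w : ℝ) :
    ∫⁻ u, erlangPDF ξ n u * erlangPDF ξ 0 (w - u) = erlangPDF ξ (n + 1) w := by
  have h : ∀ u, erlangPDF ξ n u * erlangPDF ξ 0 (w - u) = (Ioo 0 w).indicator
      (fun u => ENNReal.ofReal (ξ ^ (n + 2) / n.factorial * Real.exp (-(ξ * w)) * u ^ n)) u := by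
    intro u
    by_cases hu : u ∈ Ioo 0 w
    · have h₁ : u ∈ Ioi (0 : ℝ) := hu.1
      have h₂ : w - u ∈ Ioi (0 : ℝ) := sub_pos.2 hu.2
      have h₃ : 0 < u := hu.1
      rw [erlangPDF, erlangPDF, indicator_of_mem hu, indicator_of_mem h₁, indicator_of_mem h₂,
        ← ENNReal.ofReal_mul (by positivity)]
      congr 1
      rw [show -(ξ * w) = -(ξ * u) + -(ξ * (w - u)) by ring, Real.exp_add]
      simp
      ring
    · rw [indicator_of_notMem hu]
      by_cases h₁ : u ∈ Ioi (0 : ℝ)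
      · have h₂ : w - u ∉ Ioi (0 : ℝ) := fun h₂ => hu ⟨h₁, sub_pos.1 h₂⟩
        rw [erlangPDF, erlangPDF, indicator_of_notMem h₂, mul_zero]
      · rw [erlangPDF, indicator_of_notMem h₁, zero_mul]
  simp_rw [h]
  rw [lintegral_indicator measurableSet_Ioo, erlangPDF]
  by_cases hw : w ∈ Ioi (0 : ℝ)
  · have hw' : 0 < w := hw
    rw [indicator_of_mem hw, ← ofReal_integral_eq_lintegral_ofReal]
    · congr 1
      rw [← integral_Ioc_eq_integral_Ioo, ← intervalIntegral.integral_of_le hw'.le,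
        intervalIntegral.integral_const_mul, integral_pow, Nat.factorial_succ]
      push_cast
      field_simp
      ring
    · exact (Continuous.integrableOn_Icc (by fun_prop)).mono_set Ioo_subset_Icc_self
    · filter_upwards [ae_restrict_mem measurableSet_Ioo] with u hu
      have := hu.1
      positivity
  · rw [indicator_of_notMem hw, Ioo_eq_empty (by simpa using hw)]
    simp

variable {ξ : ℝ} {R : ℕ → Ω → ℝ}

theorem IsPoissonIntertimes.indepFun_epoch [IsProbabilityMeasure P]
    (hR : IsPoissonIntertimes P ξ R) (n : ℕ) :
    IndepFun (fun ω => epoch (fun k => R k ω) n) (R n) P := by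
  have h := hR.indep.indepFun_finsetSum_of_notMem hR.measurable (s := Finset.range n) (i := n)
    (by simp)
  convert h using 1
  ext ω
  simp [epoch]

theorem IsPoissonIntertimes.measurable_epoch (hR : IsPoissonIntertimes P ξ R) (n : ℕ) :
    Measurable fun ω => epoch (fun k => R k ω) n :=
  (ResetTelegraph.measurable_epoch n).comp (measurable_pi_lambda _ hR.measurable)

theorem IsPoissonIntertimes.lintegral_comp (hR : IsPoissonIntertimes P ξ R) (n : ℕ)
    {f : ℝ → ℝ≥0∞} (hf : Measurable f) :
    ∫⁻ ω, f (R n ω) ∂P = ∫⁻ x, f x ∂expMeasure ξ := by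
  rw [← hR.law n, lintegral_map hf (hR.measurable n)]

/-- Each new epoch adds an independent exponential time, so by induction the densities are
convolved. -/
theorem IsPoissonIntertimes.lintegral_comp_epoch_succ [IsProbabilityMeasure P] (hξ : 0 < ξ)
    (hR : IsPoissonIntertimes P ξ R) (n : ℕ) {f : ℝ → ℝ≥0∞} (hf : Measurable f) :
    ∫⁻ ω, f (epoch (fun k => R k ω) (n + 1)) ∂P = ∫⁻ u, erlangPDF ξ n u * f u := by
  induction n generalizing f with
  | zero =>
    simp only [epoch_succ, epoch_zero, zero_add]
    rw [hR.lintegral_comp 0 hf, lintegral_expMeasure ξ hf]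
  | succ n ih =>
    simp only [epoch_succ _ (n + 1)]
    have hm : Measurable fun u => ∫⁻ x, erlangPDF ξ 0 x * f (u + x) := by
      refine Measurable.lintegral_prod_right'
        (f := fun p : ℝ × ℝ => erlangPDF ξ 0 p.2 * f (p.1 + p.2)) ?_
      exact ((measurable_erlangPDF ξ 0).comp measurable_snd).mul (hf.comp (by fun_prop))
    rw [lintegral_comp_prodMk_of_indepFun (hR.measurable_epoch (n + 1)) (hR.measurable (n + 1))
      (hR.indepFun_epoch (n + 1)) (F := fun p => f (p.1 + p.2)) (hf.comp (by fun_prop))]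
    have h : ∀ u, ∫⁻ ω, f (u + R (n + 1) ω) ∂P = ∫⁻ x, erlangPDF ξ 0 x * f (u + x) := by
      intro u
      have hfu : Measurable fun x => f (u + x) := hf.comp (by fun_prop)
      rw [hR.lintegral_comp (n + 1) hfu, lintegral_expMeasure ξ hfu]
    simp only [h]
    rw [ih hm]
    have h' : ∀ u, erlangPDF ξ n u * ∫⁻ x, erlangPDF ξ 0 x * f (u + x) =
        ∫⁻ w, erlangPDF ξ n u * erlangPDF ξ 0 (w - u) * f w := by
      intro u
      have hmeas : Measurable fun w => erlangPDF ξ 0 (w - u) * f w :=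
        ((measurable_erlangPDF ξ 0).comp (by fun_prop)).mul hf
      rw [← lintegral_add_left_eq_self (μ := volume)
        (fun w => erlangPDF ξ n u * erlangPDF ξ 0 (w - u) * f w) u]
      simp only [mul_assoc, add_sub_cancel_left]
      rw [lintegral_const_mul]
      exact (measurable_erlangPDF ξ 0).mul (hf.comp (by fun_prop))
    simp only [h']
    rw [lintegral_lintegral_swap]
    · refine lintegral_congr fun w => ?_
      rw [lintegral_mul_const, lintegral_erlangPDF_mul hξ]
      exact (measurable_erlangPDF ξ n).mul ((measurable_erlangPDF ξ 0).comp (by fun_prop))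
    · exact ((((measurable_erlangPDF ξ n).comp measurable_fst).mul
        ((measurable_erlangPDF ξ 0).comp (measurable_snd.sub measurable_fst))).mul
        (hf.comp measurable_snd)).aemeasurable

/-- The expected number of epochs has the density `ξ`. -/
theorem IsPoissonIntertimes.tsum_lintegral_comp_epoch_succ [IsProbabilityMeasure P] (hξ : 0 < ξ)
    (hR : IsPoissonIntertimes P ξ R) {f : ℝ → ℝ≥0∞} (hf : Measurable f) :
    ∑' n, ∫⁻ ω, f (epoch (fun k => R k ω) (n + 1)) ∂P =
      ENNReal.ofReal ξ * ∫⁻ u in Ioi 0, f u := by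
  simp_rw [hR.lintegral_comp_epoch_succ hξ _ hf]
  rw [← lintegral_tsum (f := fun n u => erlangPDF ξ n u * f u)
      fun n => ((measurable_erlangPDF ξ n).mul hf).aemeasurable,
    ← lintegral_const_mul _ hf, ← lintegral_indicator measurableSet_Ioi]
  refine lintegral_congr fun u => ?_
  rw [ENNReal.tsum_mul_right, tsum_erlangPDF hξ]
  by_cases hu : u ∈ Ioi (0 : ℝ)
  · simp [indicator_of_mem hu]
  · simp [indicator_of_notMem hu]

theorem IsPoissonIntertimes.ae_isRegular [IsProbabilityMeasure P] (hξ : 0 < ξ)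
    (hR : IsPoissonIntertimes P ξ R) : ∀ᵐ ω ∂P, IsRegular fun k => R k ω := by
  have hp : ∀ᵐ ω ∂P, ∀ k, 0 < R k ω := by
    refine ae_all_iff.2 fun k => ?_
    have h := ae_pos_expMeasure hξ
    rw [← hR.law k] at h
    exact ae_of_ae_map (hR.measurable k).aemeasurable h
  have hu : ∀ᵐ ω ∂P, ∀ t, ∃ n, t < epoch (fun k => R k ω) n := by
    refine ae_unbounded_epoch (p := fun z n => P {ω | epoch (fun k => R k ω) n ≤ z})
      (fun z hz => ?_) fun _ _ _ => le_rfl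
    -- The probabilities of the epochs from index one on sum to the mean number of epochs in `(0,
    -- z]`, which is finite, so they tend to `0`.
    rw [← tendsto_add_atTop_iff_nat 1]
    refine ENNReal.tendsto_atTop_zero_of_tsum_ne_top ?_
    have h := hR.tsum_lintegral_comp_epoch_succ hξ (f := (Iic z).indicator 1)
      (measurable_one.indicator measurableSet_Iic)
    have h' : ∀ n, ∫⁻ ω, (Iic z).indicator (1 : ℝ → ℝ≥0∞) (epoch (fun k => R k ω) (n + 1)) ∂P =
        P {ω | epoch (fun k => R k ω) (n + 1) ≤ z} := by
      intro n
      exact lintegral_indicator_one (measurableSet_le (hR.measurable_epoch _) measurable_const)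
    simp only [h'] at h
    rw [h, lintegral_indicator_one measurableSet_Iic, Measure.restrict_apply measurableSet_Iic,
      Iic_inter_Ioi, Real.volume_Ioc]
    exact ENNReal.mul_ne_top ENNReal.ofReal_ne_top ENNReal.ofReal_ne_top
  filter_upwards [hp, hu] with ω h₁ h₂
  exact ⟨h₁, h₂⟩

/-- The law of the time elapsed since the last epoch of a Poisson process. -/
theorem IsPoissonIntertimes.tsum_lintegral_age [IsProbabilityMeasure P] (hξ : 0 < ξ)
    (hR : IsPoissonIntertimes P ξ R) {t : ℝ} (ht : 0 < t) {g : ℝ → ℝ≥0∞} (hg : Measurable g) :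
    ∑' m, ∫⁻ ω, {ω | count (fun k => R k ω) t = m}.indicator
        (fun ω => g (t - epoch (fun k => R k ω) m)) ω ∂P =
      ENNReal.ofReal (Real.exp (-(ξ * t))) * g t +
        ∫⁻ s in Ioo 0 t, ENNReal.ofReal (ξ * Real.exp (-(ξ * s))) * g s := by
  -- The contribution of a reset at time `u`: the probability of no further reset up to `t`, times
  -- `g` at the age `t - u`.
  let f : ℝ → ℝ≥0∞ := (Iic t).indicator fun u =>
    ENNReal.ofReal (Real.exp (-(ξ * (t - u)))) * g (t - u)
  have hf : Measurable f :=
    Measurable.indicator (Measurable.mul (by fun_prop) (hg.comp (by fun_prop))) measurableSet_Iic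
  have key : ∀ m, ∫⁻ ω, {ω | count (fun k => R k ω) t = m}.indicator
        (fun ω => g (t - epoch (fun k => R k ω) m)) ω ∂P =
      ∫⁻ ω, f (epoch (fun k => R k ω) m) ∂P := by
    intro m
    let F : ℝ × ℝ → ℝ≥0∞ :=
      {p : ℝ × ℝ | p.1 ≤ t ∧ t - p.1 < p.2}.indicator fun p => g (t - p.1)
    have hF : Measurable F := by
      refine Measurable.indicator (hg.comp (by fun_prop)) ?_
      exact (measurableSet_le measurable_fst measurable_const).inter
        (measurableSet_lt (by fun_prop) measurable_snd)
    have h₁ : ∫⁻ ω, {ω | count (fun k => R k ω) t = m}.indicator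
        (fun ω => g (t - epoch (fun k => R k ω) m)) ω ∂P =
        ∫⁻ ω, F (epoch (fun k => R k ω) m, R m ω) ∂P := by
      refine lintegral_congr_ae ?_
      filter_upwards [hR.ae_isRegular hξ] with ω hω
      simp only [F, indicator, mem_ofPred_eq]
      have := hω.count_eq_iff (n := m) ht.le
      rw [epoch_succ, ← sub_lt_iff_lt_add'] at this
      simp only [this]
    rw [h₁, lintegral_comp_prodMk_of_indepFun (hR.measurable_epoch m) (hR.measurable m)
      (hR.indepFun_epoch m) hF]
    refine lintegral_congr fun ω => ?_
    generalize epoch (fun k => R k ω) m = u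
    rw [hR.lintegral_comp m (f := fun r => F (u, r)) (hF.comp measurable_prodMk_left)]
    by_cases hu : u ≤ t
    · have : (fun r => F (u, r)) = (Ioi (t - u)).indicator fun _ => g (t - u) := by
        ext r
        simp [F, indicator, hu]
      rw [this, lintegral_indicator_const measurableSet_Ioi, expMeasure_Ioi hξ (sub_nonneg.2 hu)]
      simp [f, hu, mul_comm]
    · have : (fun r => F (u, r)) = 0 := by
        ext r
        simp [F, hu]
      rw [this, Pi.zero_def, lintegral_zero]
      simp [f, hu]
  simp only [key]
  -- Epoch `0` is the deterministic time `0` and gives the term at age `t`; the other epochs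
  -- contribute through the constant density `ξ`.
  rw [tsum_eq_zero_add' ENNReal.summable, hR.tsum_lintegral_comp_epoch_succ hξ hf]
  congr 1
  · simp [epoch_zero, f, ht.le]
  · rw [← lintegral_const_mul _ hf, ← lintegral_indicator measurableSet_Ioi,
      ← lintegral_sub_left_eq_self _ t, ← lintegral_indicator measurableSet_Ioo]
    refine lintegral_congr_ae ?_
    filter_upwards [Measure.ae_ne volume 0] with s hs
    by_cases h : s ∈ Ioo 0 t
    · have h₁ : t - s ∈ Ioi 0 := sub_pos.2 h.2
      rw [indicator_of_mem h, indicator_of_mem h₁]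
      simp only [f]
      rw [indicator_of_mem (by simp [h.1.le]), _root_.sub_sub_cancel, ← mul_assoc,
        ← ENNReal.ofReal_mul hξ.le]
    · rw [indicator_of_notMem h]
      by_cases h₁ : t - s ∈ Ioi 0
      · have h₂ : ¬ 0 ≤ s := fun h₂ => h ⟨lt_of_le_of_ne h₂ hs.symm, sub_pos.1 h₁⟩
        rw [indicator_of_mem h₁]
        simp only [f]
        rw [indicator_of_notMem (by simpa using h₂), mul_zero]
      · rw [indicator_of_notMem h₁]

end

section

open Set Filter Topology ENNReal

/-! ### Integrating the law of the motion over the time since the last reset -/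

theorem ofDensity_apply (f : ℝ → ℝ) {A : Set ℝ} (hA : MeasurableSet A) :
    ofDensity f A = ∫⁻ x in A, ENNReal.ofReal (f x) :=
  withDensity_apply _ hA

theorem motionLaw_apply (v₁ v₂ lam : ℝ) (j : Fin 2) (s : ℝ) {A : Set ℝ} (hA : MeasurableSet A) :
    motionLaw v₁ v₂ lam j s A =
      ENNReal.ofReal (1 / (1 + lam * s)) * A.indicator 1 (vel v₁ v₂ j * s) +
      ∫⁻ x in A, (Ioo (v₂ * s) (v₁ * s)).indicator
        (fun _ => ENNReal.ofReal (lam / ((v₁ - v₂) * (1 + lam * s)))) x := by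
  rw [motionLaw, Measure.add_apply, Measure.smul_apply, Measure.smul_apply,
    Measure.dirac_apply' _ hA, lintegral_indicator_const measurableSet_Ioo,
    Measure.restrict_apply hA, Measure.restrict_apply measurableSet_Ioo, inter_comm A, smul_eq_mul,
    smul_eq_mul]

theorem measurable_motionLaw_density (v₁ v₂ lam : ℝ) :
    Measurable fun p : ℝ × ℝ => (Ioo (v₂ * p.1) (v₁ * p.1)).indicator
        (fun _ => ENNReal.ofReal (lam / ((v₁ - v₂) * (1 + lam * p.1)))) p.2 := by
  have h : MeasurableSet {p : ℝ × ℝ | v₂ * p.1 < p.2 ∧ p.2 < v₁ * p.1} :=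
    (measurableSet_lt (by fun_prop) measurable_snd).inter
      (measurableSet_lt measurable_snd (by fun_prop))
  have hf : Measurable fun p : ℝ × ℝ =>
    ENNReal.ofReal (lam / ((v₁ - v₂) * (1 + lam * p.1))) := by fun_prop
  exact hf.indicator h

theorem measurable_motionLaw_apply (v₁ v₂ lam : ℝ) (j : Fin 2) {A : Set ℝ}
    (hA : MeasurableSet A) : Measurable fun s => motionLaw v₁ v₂ lam j s A := by
  simp only [motionLaw_apply _ _ _ _ _ hA]
  have h₁ : Measurable fun s => A.indicator (1 : ℝ → ℝ≥0∞) (vel v₁ v₂ j * s) :=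
    (measurable_one.indicator hA).comp (by fun_prop)
  exact (Measurable.mul (by fun_prop) h₁).add
    (measurable_motionLaw_density v₁ v₂ lam).lintegral_prod_right'

theorem lintegral_eq_mul_lintegral_comp_mul_left {v : ℝ} (hv : v ≠ 0) {h : ℝ → ℝ≥0∞}
    (hh : Measurable h) : ∫⁻ x, h x = ENNReal.ofReal |v| * ∫⁻ s, h (v * s) := by
  conv_lhs => rw [← Real.smul_map_volume_mul_left hv]
  rw [lintegral_smul_measure, lintegral_map hh (by fun_prop), smul_eq_mul]

theorem measurable_ind {p : ℝ → Prop} (hp : MeasurableSet {x | p x}) :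
    Measurable fun x => ind (p x) := by
  unfold ind
  exact Measurable.ite hp measurable_const measurable_const

/-- Substituting `x = v * s` gives the Jacobian `|v|`; the product `|v| * sgn v = v` cancels the
factor in `v + lam * x = v * (1 + lam * s)`. -/
theorem lintegral_atom {lam ξ v t : ℝ} (hlam : 0 < lam) (hξ : 0 < ξ) (hv : v ≠ 0) {A : Set ℝ}
    (hA : MeasurableSet A) :
    ∫⁻ s in Ioo 0 t, ENNReal.ofReal (ξ * Real.exp (-(ξ * s))) *
        (ENNReal.ofReal (1 / (1 + lam * s)) * A.indicator 1 (v * s)) =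
      ofDensity (fun x => SignType.sign v * ind (0 < x / v ∧ x / v < t) *
        (ξ * Real.exp (-ξ * (x / v)) / (v + lam * x))) A := by
  have hm : Measurable fun x => SignType.sign v * ind (0 < x / v ∧ x / v < t) *
        (ξ * Real.exp (-ξ * (x / v)) / (v + lam * x)) := by
    refine Measurable.mul (measurable_const.mul (measurable_ind ?_)) (by fun_prop)
    exact measurableSet_Ioo.preimage (f := fun x : ℝ => x / v) (by fun_prop)
  have hmA := hm.ennreal_ofReal.indicator hA
  rw [ofDensity_apply _ hA, ← lintegral_indicator hA,
    lintegral_eq_mul_lintegral_comp_mul_left hv hmA,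
    ← lintegral_const_mul' _ _ ENNReal.ofReal_ne_top,
    ← lintegral_indicator measurableSet_Ioo]
  refine lintegral_congr fun s => ?_
  by_cases hsA : v * s ∈ A
  · rw [indicator_of_mem hsA, mul_div_cancel_left₀ _ hv]
    by_cases hs : s ∈ Ioo 0 t
    · have hs₀ : 0 < s := hs.1
      rw [indicator_of_mem hs, indicator_of_mem hsA, Pi.one_apply, mul_one,
        ← ENNReal.ofReal_mul (by positivity), ← ENNReal.ofReal_mul (by positivity), ind,
        if_pos ⟨hs.1, hs.2⟩]
      congr 1
      have hsign : |v| * (SignType.sign v : ℝ) = v := by rw [mul_comm, sign_mul_abs]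
      rw [mul_one, ← mul_assoc, hsign, show -ξ * s = -(ξ * s) by ring,
        show v + lam * (v * s) = v * (1 + lam * s) by ring]
      field_simp
    · rw [indicator_of_notMem hs, ind, if_neg (by simpa using hs)]
      simp
  · rw [indicator_of_notMem hsA, mul_zero]
    by_cases hs : s ∈ Ioo 0 t
    · rw [indicator_of_mem hs, indicator_of_notMem hsA, mul_zero, mul_zero]
    · rw [indicator_of_notMem hs]

/-- Under `u = ξ * s + ξ / lam` the factor `lam / (1 + lam * s)` becomes `ξ / u`, and completing the
exponent to `-u` costs `e^{ξ/lam}`. -/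
theorem lintegral_Ioo_eq_genIncGamma {v₁ v₂ lam ξ a b : ℝ} (hv : v₂ < v₁) (hlam : 0 < lam)
    (hξ : 0 < ξ) (ha : 0 ≤ a) (hab : a ≤ b) :
    ∫⁻ s in Ioo a b, ENNReal.ofReal (ξ * Real.exp (-(ξ * s))) *
        ENNReal.ofReal (lam / ((v₁ - v₂) * (1 + lam * s))) =
      ENNReal.ofReal (ξ * Real.exp (ξ / lam) / (v₁ - v₂) *
        genIncGamma 0 ((a + 1 / lam) * ξ) ((b + 1 / lam) * ξ)) := by
  have hv' : 0 < v₁ - v₂ := sub_pos.2 hv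
  have h₁ : ∀ s ∈ Ioo a b, ENNReal.ofReal (ξ * Real.exp (-(ξ * s))) *
        ENNReal.ofReal (lam / ((v₁ - v₂) * (1 + lam * s))) =
      ENNReal.ofReal (ξ * Real.exp (-(ξ * s)) * (lam / ((v₁ - v₂) * (1 + lam * s)))) :=
    fun s _ => (ENNReal.ofReal_mul (by positivity)).symm
  rw [setLIntegral_congr_fun measurableSet_Ioo h₁, ← ofReal_integral_eq_lintegral_ofReal]
  · congr 1
    rw [← integral_Ioc_eq_integral_Ioo, ← intervalIntegral.integral_of_le hab, genIncGamma,
      show (a + 1 / lam) * ξ = ξ * a + ξ / lam by ring,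
      show (b + 1 / lam) * ξ = ξ * b + ξ / lam by ring]
    have h₂ := intervalIntegral.mul_integral_comp_mul_add (a := a) (b := b)
      (f := fun u : ℝ => u ^ ((0 : ℝ) - 1) * Real.exp (-u)) (c := ξ) (d := ξ / lam)
    rw [← h₂, ← mul_assoc, ← intervalIntegral.integral_const_mul]
    refine intervalIntegral.integral_congr fun s hs => ?_
    rw [uIcc_of_le hab] at hs
    have hs₀ : 0 ≤ s := ha.trans hs.1
    rw [zero_sub, Real.rpow_neg_one, neg_add, Real.exp_add, Real.exp_neg (ξ / lam)]
    have : (0 : ℝ) < Real.exp (ξ / lam) := Real.exp_pos _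
    field_simp
    ring
  · refine (ContinuousOn.integrableOn_Icc ?_).mono_set Ioo_subset_Icc_self
    refine ContinuousOn.mul (by fun_prop) (ContinuousOn.div (by fun_prop) (by fun_prop) ?_)
    intro s hs
    have : 0 ≤ s := ha.trans hs.1
    positivity
  · filter_upwards [ae_restrict_mem measurableSet_Ioo] with s hs
    have : 0 ≤ s := ha.trans hs.1.le
    positivity

theorem lintegral_motionLaw_density {v₁ v₂ lam ξ t : ℝ} (hv : v₂ < v₁) (hv₁ : 0 < v₁)
    (hv₂ : v₂ ≠ 0) (hlam : 0 < lam) (hξ : 0 < ξ) (ht : 0 < t) (x : ℝ) :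
    ∫⁻ s in Ioo 0 t, ENNReal.ofReal (ξ * Real.exp (-(ξ * s))) *
        (Ioo (v₂ * s) (v₁ * s)).indicator
          (fun _ => ENNReal.ofReal (lam / ((v₁ - v₂) * (1 + lam * s)))) x =
      ENNReal.ofReal (ξ * Real.exp (ξ / lam) / (v₁ - v₂) *
        ind (min (v₂ * t) 0 < x ∧ x < v₁ * t) * gammaFun v₁ v₂ lam ξ x t) := by
  let f : ℝ → ℝ≥0∞ := fun s => ENNReal.ofReal (ξ * Real.exp (-(ξ * s))) *
        ENNReal.ofReal (lam / ((v₁ - v₂) * (1 + lam * s)))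
  have hset : MeasurableSet {s : ℝ | v₂ * s < x ∧ x < v₁ * s} :=
    (measurableSet_lt (f := fun s => v₂ * s) (by fun_prop) measurable_const).inter
      (measurableSet_lt (g := fun s => v₁ * s) measurable_const (by fun_prop))
  have h₁ : ∀ s, ENNReal.ofReal (ξ * Real.exp (-(ξ * s))) *
        (Ioo (v₂ * s) (v₁ * s)).indicator
          (fun _ => ENNReal.ofReal (lam / ((v₁ - v₂) * (1 + lam * s)))) x =
      {s : ℝ | v₂ * s < x ∧ x < v₁ * s}.indicator f s := by
    intro s
    by_cases hs : v₂ * s < x ∧ x < v₁ * s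
    · rw [indicator_of_mem (by exact hs), indicator_of_mem (by exact hs)]
    · rw [indicator_of_notMem (by exact hs), indicator_of_notMem (by exact hs), mul_zero]
  simp_rw [h₁]
  rw [lintegral_indicator hset, Measure.restrict_restrict hset]
  have e₁ : ∀ s, x < v₁ * s ↔ x / v₁ < s := fun s => (div_lt_iff₀' hv₁).symm
  rcases hv₂.lt_or_gt with hneg | hpos
  · have e₂ : ∀ s, v₂ * s < x ↔ x / v₂ < s := fun s => (div_lt_iff_of_neg' hneg).symm
    -- The two quotients have opposite signs (or vanish), so the constraint `0 < s` is implied by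
    -- the other two.
    have hmax : 0 ≤ max (x / v₁) (x / v₂) := by
      rcases le_or_gt 0 x with hx | hx
      · exact le_max_of_le_left (by positivity)
      · exact le_max_of_le_right (div_nonneg_of_nonpos hx.le hneg.le)
    have hS : {s : ℝ | v₂ * s < x ∧ x < v₁ * s} ∩ Ioo 0 t = Ioo (max (x / v₁) (x / v₂)) t := by
      ext s
      simp only [mem_inter_iff, mem_ofPred_eq, mem_Ioo, e₁, e₂]
      rw [max_lt_iff]
      constructor
      · rintro ⟨⟨h₁, h₂⟩, h₃, h₄⟩
        exact ⟨⟨h₂, h₁⟩, h₄⟩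
      · rintro ⟨⟨h₁, h₂⟩, h₃⟩
        exact ⟨⟨h₂, h₁⟩, hmax.trans_lt (max_lt h₁ h₂), h₃⟩
    have hind : (min (v₂ * t) 0 < x ∧ x < v₁ * t) ↔ max (x / v₁) (x / v₂) < t := by
      rw [min_eq_left (by nlinarith), e₁, e₂, max_lt_iff, and_comm]
    rw [hS, gammaFun, if_pos hneg, ind]
    by_cases hxt : max (x / v₁) (x / v₂) < t
    · rw [if_pos (hind.2 hxt), mul_one]
      exact lintegral_Ioo_eq_genIncGamma hv hlam hξ hmax hxt.le
    · rw [if_neg (fun h => hxt (hind.1 h)), Ioo_eq_empty hxt]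
      simp
  · have e₂ : ∀ s, v₂ * s < x ↔ s < x / v₂ := fun s => (lt_div_iff₀' hpos).symm
    rw [gammaFun, if_neg hpos.not_gt, ind, min_eq_right (by positivity)]
    -- Now `x / v₂` bounds the age from above, and for `0 < x < v₁ * t` the admissible ages form the
    -- interval from `x / v₁` to `min (x / v₂) t`.
    by_cases hx : 0 < x ∧ x < v₁ * t
    · have hS : {s : ℝ | v₂ * s < x ∧ x < v₁ * s} ∩ Ioo 0 t = Ioo (x / v₁) (min (x / v₂) t) := by
        ext s
        simp only [mem_inter_iff, mem_ofPred_eq, mem_Ioo, e₁, e₂]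
        rw [lt_min_iff]
        have : 0 < x / v₁ := div_pos hx.1 hv₁
        constructor
        · rintro ⟨⟨h₁, h₂⟩, h₃, h₄⟩
          exact ⟨h₂, h₁, h₄⟩
        · rintro ⟨h₁, h₂, h₃⟩
          exact ⟨⟨h₂, h₁⟩, this.trans h₁, h₃⟩
      rw [hS, if_pos hx, mul_one]
      refine lintegral_Ioo_eq_genIncGamma hv hlam hξ (div_pos hx.1 hv₁).le (le_min ?_ ?_)
      · exact div_le_div_of_nonneg_left hx.1.le hpos hv.le
      · exact ((e₁ t).1 hx.2).le
    · have hS : {s : ℝ | v₂ * s < x ∧ x < v₁ * s} ∩ Ioo 0 t = ∅ := by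
        ext s
        simp only [mem_inter_iff, mem_ofPred_eq, mem_Ioo, mem_empty_iff_false, iff_false]
        rintro ⟨⟨h₁, h₂⟩, h₃, h₄⟩
        exact hx ⟨by nlinarith, by nlinarith⟩
      rw [hS, if_neg hx]
      simp

/-- The law of the position at time `t` of the motion with resets and with initial velocity of
index `j`: an average over the time since the last reset. -/
theorem exp_mul_motionLaw_add_lintegral {v₁ v₂ lam ξ t : ℝ} (hv : v₂ < v₁) (hv₁ : 0 < v₁)
    (hv₂ : v₂ ≠ 0) (hlam : 0 < lam) (hξ : 0 < ξ) (ht : 0 < t) (j : Fin 2) {A : Set ℝ}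
    (hA : MeasurableSet A) :
    ENNReal.ofReal (Real.exp (-(ξ * t))) * motionLaw v₁ v₂ lam j t A +
        ∫⁻ s in Ioo 0 t, ENNReal.ofReal (ξ * Real.exp (-(ξ * s))) * motionLaw v₁ v₂ lam j s A =
      H lam ξ (vel v₁ v₂ j) t A +
        ofDensity (fun x => ind (v₂ * t < x ∧ x < v₁ * t) *
            (lam * Real.exp (-ξ * t) / ((v₁ - v₂) * (1 + lam * t)))) A +
        ofDensity (fun x => ξ * Real.exp (ξ / lam) / (v₁ - v₂) *
            ind (min (v₂ * t) 0 < x ∧ x < v₁ * t) * gammaFun v₁ v₂ lam ξ x t) A := by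
  have hv' : 0 < v₁ - v₂ := sub_pos.2 hv
  have hvel : vel v₁ v₂ j ≠ 0 := by
    unfold vel
    split_ifs
    exacts [hv₁.ne', hv₂]
  have hmI : Measurable fun s => A.indicator (1 : ℝ → ℝ≥0∞) (vel v₁ v₂ j * s) :=
    (measurable_one.indicator hA).comp (by fun_prop)
  have hmd := measurable_motionLaw_density v₁ v₂ lam
  simp only [motionLaw_apply _ _ _ _ _ hA, mul_add (ENNReal.ofReal _)]
  rw [lintegral_add_left (f := fun s => ENNReal.ofReal (ξ * Real.exp (-(ξ * s))) *
      (ENNReal.ofReal (1 / (1 + lam * s)) * A.indicator 1 (vel v₁ v₂ j * s)))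
      (Measurable.mul (by fun_prop) (Measurable.mul (by fun_prop) hmI)),
    lintegral_atom hlam hξ hvel hA]
  have h₁ : ENNReal.ofReal (Real.exp (-(ξ * t))) *
      (ENNReal.ofReal (1 / (1 + lam * t)) * A.indicator 1 (vel v₁ v₂ j * t)) =
      (ENNReal.ofReal (Real.exp (-ξ * t) / (1 + lam * t)) •
        Measure.dirac (vel v₁ v₂ j * t) : Measure ℝ) A := by
    rw [Measure.smul_apply, Measure.dirac_apply' _ hA, smul_eq_mul, ← mul_assoc,
      ← ENNReal.ofReal_mul (by positivity), mul_one_div, neg_mul]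
  have h₂ : ENNReal.ofReal (Real.exp (-(ξ * t))) * ∫⁻ x in A, (Ioo (v₂ * t) (v₁ * t)).indicator
        (fun _ => ENNReal.ofReal (lam / ((v₁ - v₂) * (1 + lam * t)))) x =
      ofDensity (fun x => ind (v₂ * t < x ∧ x < v₁ * t) *
            (lam * Real.exp (-ξ * t) / ((v₁ - v₂) * (1 + lam * t)))) A := by
    rw [ofDensity_apply _ hA,
      ← lintegral_const_mul _ (measurable_const.indicator measurableSet_Ioo)]
    refine lintegral_congr fun x => ?_
    by_cases hx : v₂ * t < x ∧ x < v₁ * t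
    · rw [indicator_of_mem (by exact hx), ind, if_pos hx, ← ENNReal.ofReal_mul (by positivity)]
      congr 1
      rw [neg_mul]
      ring
    · rw [indicator_of_notMem (by exact hx), ind, if_neg hx]
      simp
  have h₃ : ∫⁻ s in Ioo 0 t, ENNReal.ofReal (ξ * Real.exp (-(ξ * s))) *
        ∫⁻ x in A, (Ioo (v₂ * s) (v₁ * s)).indicator
          (fun _ => ENNReal.ofReal (lam / ((v₁ - v₂) * (1 + lam * s)))) x =
      ofDensity (fun x => ξ * Real.exp (ξ / lam) / (v₁ - v₂) *
            ind (min (v₂ * t) 0 < x ∧ x < v₁ * t) * gammaFun v₁ v₂ lam ξ x t) A := by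
    have h₄ : ∀ s, ENNReal.ofReal (ξ * Real.exp (-(ξ * s))) *
        ∫⁻ x in A, (Ioo (v₂ * s) (v₁ * s)).indicator
          (fun _ => ENNReal.ofReal (lam / ((v₁ - v₂) * (1 + lam * s)))) x =
        ∫⁻ x in A, ENNReal.ofReal (ξ * Real.exp (-(ξ * s))) * (Ioo (v₂ * s) (v₁ * s)).indicator
          (fun _ => ENNReal.ofReal (lam / ((v₁ - v₂) * (1 + lam * s)))) x := fun s =>
      (lintegral_const_mul _ (measurable_const.indicator measurableSet_Ioo)).symm
    simp_rw [h₄]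
    -- Tonelli: the age is integrated out first, at a fixed position `x`.
    rw [ofDensity_apply _ hA, lintegral_lintegral_swap]
    · exact lintegral_congr fun x => lintegral_motionLaw_density hv hv₁ hv₂ hlam hξ ht x
    · exact Measurable.aemeasurable (Measurable.mul (by fun_prop) hmd)
  rw [h₁, h₂, h₃, H, Measure.add_apply]
  ring

end

section

open Set Filter Topology ENNReal

/-! ### The law of the motion with resets -/

variable {Ω : Type*} [MeasurableSpace Ω] {P : Measure Ω} {q lam ξ : ℝ} {J : Ω → Fin 2}
  {R : ℕ → Ω → ℝ} {D : ℕ → Fin 2 → ℕ → Ω → ℝ}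

theorem IsDrivingSystem.measurable_resets (h : IsDrivingSystem P q lam ξ J R D) :
    Measurable fun ω k => R k ω :=
  measurable_pi_lambda _ h.resets.measurable

theorem IsDrivingSystem.measurable_durations (h : IsDrivingSystem P q lam ξ J R D) (m : ℕ) :
    Measurable fun ω i k => D m i k ω :=
  measurable_pi_lambda _ fun i => measurable_pi_lambda _ fun k => (h.durations m i).measurable k

theorem IsDrivingSystem.measurable_resetPosition (h : IsDrivingSystem P q lam ξ J R D)
    (v₁ v₂ t : ℝ) : Measurable fun ω => resetPosition v₁ v₂ (J ω) (fun k => R k ω)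
        (fun m i k => D m i k ω) t := by
  have hm : Measurable fun ω => (J ω, (fun k => R k ω), fun m i k => D m i k ω) :=
    h.measurable_initial.prodMk (h.measurable_resets.prodMk
      (measurable_pi_lambda _ h.measurable_durations))
  have hc := (ResetTelegraph.measurable_resetPosition v₁ v₂ t).comp hm
  simpa only [Function.comp_def] using hc

/-- The contribution of the event that `m` resets occur up to time `t`. -/
theorem IsDrivingSystem.measure_count_eq_and_position_mem [IsProbabilityMeasure P]
    (h : IsDrivingSystem P q lam ξ J R D) {v₁ v₂ t : ℝ} (hv : v₂ < v₁) (hlam : 0 < lam)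
    (hξ : 0 < ξ) (ht : 0 < t) (j : Fin 2) (m : ℕ) {A : Set ℝ} (hA : MeasurableSet A) :
    P (J ⁻¹' {j} ∩ {ω | count (fun k => R k ω) t = m ∧
        position v₁ v₂ j (fun i k => D m i k ω) (t - epoch (fun k => R k ω) m) ∈ A}) =
      P (J ⁻¹' {j}) * ∫⁻ ω, {ω | count (fun k => R k ω) t = m}.indicator
        (fun ω => motionLaw v₁ v₂ lam j (t - epoch (fun k => R k ω) m) A) ω ∂P := by
  have hRm := h.measurable_resets
  have hDm := h.measurable_durations m
  let B : Set ((ℕ → ℝ) × (Fin 2 → ℕ → ℝ)) :=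
    {p | count p.1 t = m ∧ position v₁ v₂ j p.2 (t - epoch p.1 m) ∈ A}
  have hB : MeasurableSet B := by
    have hc : Measurable fun p : (ℕ → ℝ) × (Fin 2 → ℕ → ℝ) => (p.1, t) := by fun_prop
    have hp : Measurable fun p : (ℕ → ℝ) × (Fin 2 → ℕ → ℝ) => (p.2, t - epoch p.1 m) := by
      fun_prop
    have h₁ := (measurable_count.comp hc) (measurableSet_singleton m)
    have h₂ := ((measurable_position v₁ v₂ j).comp hp) hA
    exact h₁.inter h₂
  have hpre : {ω | count (fun k => R k ω) t = m ∧
        position v₁ v₂ j (fun i k => D m i k ω) (t - epoch (fun k => R k ω) m) ∈ A} =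
      (fun ω => ((fun k => R k ω), fun i k => D m i k ω)) ⁻¹' B := rfl
  rw [hpre, (h.indep_initial m).measure_inter_preimage_eq_mul _ _ (measurableSet_singleton j) hB]
  congr 1
  rw [← lintegral_indicator_one ((hRm.prodMk hDm) hB)]
  have hBi : Measurable (B.indicator (1 : (ℕ → ℝ) × (Fin 2 → ℕ → ℝ) → ℝ≥0∞)) :=
    measurable_one.indicator hB
  -- The resets are frozen at `ω` and the durations of cycle `m` integrated over an independent copy
  -- `ω'`, so the age becomes a constant and `map_position` applies.
  have h₁ := lintegral_comp_prodMk_of_indepFun hRm hDm (h.indep_resets m) hBi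
  refine Eq.trans h₁ (lintegral_congr_ae ?_)
  filter_upwards [h.resets.ae_isRegular hξ] with ω hω
  by_cases hc : count (fun k => R k ω) t = m
  · have hs : 0 ≤ t - epoch (fun k => R k ω) m := sub_nonneg.2 ((hω.count_eq_iff ht.le).1 hc).1
    have hpm : Measurable fun ω' =>
        position v₁ v₂ j (fun i k => D m i k ω') (t - epoch (fun k => R k ω) m) := by
      have hp : Measurable fun ω' =>
          ((fun i k => D m i k ω'), t - epoch (fun k => R k ω) m) := hDm.prodMk measurable_const
      have hc := (measurable_position v₁ v₂ j).comp hp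
      simpa only [Function.comp_def] using hc
    rw [indicator_of_mem (by exact hc),
      ← map_position hv hlam (h.durations m) (h.indep_durations m) j hs, Measure.map_apply hpm hA,
      ← lintegral_indicator_one (hpm hA)]
    refine lintegral_congr fun ω' => ?_
    by_cases hω' : position v₁ v₂ j (fun i k => D m i k ω') (t - epoch (fun k => R k ω) m) ∈ A
    · rw [indicator_of_mem (by exact ⟨hc, hω'⟩), indicator_of_mem (by exact hω'), Pi.one_apply,
        Pi.one_apply]
    · rw [indicator_of_notMem (by exact fun h' => hω' h'.2), indicator_of_notMem (by exact hω')]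
  · rw [indicator_of_notMem (by exact hc)]
    simp [indicator, B, hc]

/-- The event is split by the number `m` of resets. Each piece involves the durations of cycle `m`
alone, so the joint law of different cycles never enters. -/
theorem IsDrivingSystem.measure_resetPosition_mem [IsProbabilityMeasure P]
    (h : IsDrivingSystem P q lam ξ J R D) {v₁ v₂ t : ℝ} (hv : v₂ < v₁) (hlam : 0 < lam)
    (hξ : 0 < ξ) (ht : 0 < t) (j : Fin 2) {A : Set ℝ} (hA : MeasurableSet A) :
    P (J ⁻¹' {j} ∩ (fun ω => resetPosition v₁ v₂ (J ω) (fun k => R k ω)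
        (fun m i k => D m i k ω) t) ⁻¹' A) =
      P (J ⁻¹' {j}) * (ENNReal.ofReal (Real.exp (-(ξ * t))) * motionLaw v₁ v₂ lam j t A +
        ∫⁻ s in Ioo 0 t, ENNReal.ofReal (ξ * Real.exp (-(ξ * s))) *
          motionLaw v₁ v₂ lam j s A) := by
  let E : ℕ → Set Ω := fun m => J ⁻¹' {j} ∩ {ω | count (fun k => R k ω) t = m ∧
        position v₁ v₂ j (fun i k => D m i k ω) (t - epoch (fun k => R k ω) m) ∈ A}
  have hE : J ⁻¹' {j} ∩ (fun ω => resetPosition v₁ v₂ (J ω) (fun k => R k ω)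
        (fun m i k => D m i k ω) t) ⁻¹' A = ⋃ m, E m := by
    ext ω
    simp only [E, mem_inter_iff, mem_preimage, mem_singleton_iff, mem_iUnion, mem_ofPred_eq,
      exists_and_left, exists_eq_left', resetPosition]
    constructor
    · rintro ⟨rfl, h⟩
      exact ⟨rfl, h⟩
    · rintro ⟨rfl, h⟩
      exact ⟨rfl, h⟩
  have hEm : ∀ m, MeasurableSet (E m) := by
    intro m
    have hc : Measurable fun ω => ((fun k => R k ω), t) :=
      h.measurable_resets.prodMk measurable_const
    have hp : Measurable fun ω => ((fun i k => D m i k ω), t - epoch (fun k => R k ω) m) :=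
      (h.measurable_durations m).prodMk ((h.resets.measurable_epoch m).const_sub t)
    have h₁ := (measurable_count.comp hc) (measurableSet_singleton m)
    have h₂ := ((measurable_position v₁ v₂ j).comp hp) hA
    exact (h.measurable_initial (measurableSet_singleton j)).inter (h₁.inter h₂)
  have hdisj : Pairwise (Function.onFun Disjoint E) := by
    intro m n hmn
    refine Set.disjoint_left.2 fun ω h₁ h₂ => hmn ?_
    exact h₁.2.1.symm.trans h₂.2.1
  rw [hE, measure_iUnion hdisj hEm]
  simp only [E, h.measure_count_eq_and_position_mem hv hlam hξ ht j _ hA]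
  rw [ENNReal.tsum_mul_left, h.resets.tsum_lintegral_age hξ ht
    (measurable_motionLaw_apply v₁ v₂ lam j hA)]

end

end ResetTelegraph

end

-- The law for a random initial velocity

theorem mainTheorem8 {Ω : Type*} [MeasurableSpace Ω] (P : Measure Ω) [IsProbabilityMeasure P]
    (v₁ v₂ lam ξ q : ℝ) (hv : v₂ < v₁) (hv₁ : 0 < v₁) (hv₂ : v₂ ≠ 0)
    (hlam : 0 < lam) (hξ : 0 < ξ) (hq₀ : 0 ≤ q) (hq₁ : q ≤ 1)
    (J : Ω → Fin 2) (R : ℕ → Ω → ℝ) (D : ℕ → Fin 2 → ℕ → Ω → ℝ)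
    (hsys : ResetTelegraph.IsDrivingSystem P q lam ξ J R D) (t : ℝ) (ht : 0 < t) :
    HasLaw
      (fun ω => ResetTelegraph.resetPosition v₁ v₂ (J ω) (fun k => R k ω)
        (fun m i k => D m i k ω) t)
      ((ENNReal.ofReal q • ResetTelegraph.H lam ξ v₁ t +
          ENNReal.ofReal (1 - q) • ResetTelegraph.H lam ξ v₂ t) +
        ResetTelegraph.ofDensity (fun x =>
          ResetTelegraph.ind (v₂ * t < x ∧ x < v₁ * t) *
            (lam * Real.exp (-ξ * t) / ((v₁ - v₂) * (1 + lam * t)))) +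
        ResetTelegraph.ofDensity (fun x =>
          ξ * Real.exp (ξ / lam) / (v₁ - v₂) *
            ResetTelegraph.ind (min (v₂ * t) 0 < x ∧ x < v₁ * t) *
            ResetTelegraph.gammaFun v₁ v₂ lam ξ x t))
      P := by
  have hX := hsys.measurable_resetPosition v₁ v₂ t
  refine ⟨hX.aemeasurable, Measure.ext fun A hA => ?_⟩
  have hsum : ∀ S : Set Ω, MeasurableSet S → P S = P (J ⁻¹' {0} ∩ S) + P (J ⁻¹' {1} ∩ S) := by
    intro S hS
    have h₀ : MeasurableSet (J ⁻¹' {0}) := hsys.measurable_initial (measurableSet_singleton 0)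
    have h₁ : S \ J ⁻¹' {0} = J ⁻¹' {1} ∩ S := by
      ext ω
      simp only [Set.mem_sdiff, Set.mem_preimage, Set.mem_singleton_iff, Set.mem_inter_iff]
      have : J ω = 1 ↔ ¬ J ω = 0 := by omega
      rw [this, and_comm]
    rw [← measure_inter_add_sdiff S h₀, h₁, Set.inter_comm]
  have hJ₀ : P (J ⁻¹' {0}) = ENNReal.ofReal q := hsys.initial_zero
  have hJ₁ : P (J ⁻¹' {1}) = ENNReal.ofReal (1 - q) := hsys.initial_one
  have hq : ENNReal.ofReal q + ENNReal.ofReal (1 - q) = 1 := by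
    rw [← ENNReal.ofReal_add hq₀ (sub_nonneg.2 hq₁), add_sub_cancel, ENNReal.ofReal_one]
  -- The terms `x` and `y` are common to both initial velocities, so their weights add up to one.
  have hd : ∀ a b H₁ H₂ x y : ENNReal, a + b = 1 →
      a * (H₁ + x + y) + b * (H₂ + x + y) = a * H₁ + b * H₂ + x + y := by
    intro a b H₁ H₂ x y hab
    calc a * (H₁ + x + y) + b * (H₂ + x + y)
        = a * H₁ + b * H₂ + (a + b) * x + (a + b) * y := by ring
      _ = _ := by rw [hab, one_mul, one_mul]
  rw [Measure.map_apply hX hA, hsum _ (hX hA),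
    hsys.measure_resetPosition_mem hv hlam hξ ht 0 hA,
    hsys.measure_resetPosition_mem hv hlam hξ ht 1 hA, hJ₀, hJ₁,
    ResetTelegraph.exp_mul_motionLaw_add_lintegral hv hv₁ hv₂ hlam hξ ht 0 hA,
    ResetTelegraph.exp_mul_motionLaw_add_lintegral hv hv₁ hv₂ hlam hξ ht 1 hA, hd _ _ _ _ _ _ hq]
  rfl
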